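/- Let $p$ be a prime, $n\ge 1$ an integer, $R$ an $\mathbb F_p$-algebra and $\lambda\in R$. Let $\mathcal G^{(\lambda)}=\operatorname{Spec}R[T,\frac1{1+\lambda T}]$ be the commutative $R$-group scheme with comultiplication $T\mapsto T\otimes1+1\otimes T+\lambda\,T\otimes T$, counit $T\mapsto 0$ and antipode $T\mapsto -T/(1+\lambda T)$; let $\Gamma=\Gamma^{(\lambda)}=\operatorname{Spec}R[T]/(T^{p^n})$, with the structure given by the same formulas, let $e:\Gamma\to\mathcal G^{(\lambda)}$ be the embedding $T\mapsto T$, and let $F^n:\mathcal G^{(\lambda)}\to\mathcal G^{(\lambda^{p^n})}$ be given by $T\mapsto T^{p^n}$. Let $U(\Gamma)$ be the unit group scheme of the group algebra of $\Gamma$, representing $A\mapsto \operatorname{Hom}_R(\mathcal O(\Gamma),A)^\times$ (units for the convolution product). With respect to the basis $e_s=T^s$ $(0\le s\le p^n-1)$ of $H=\mathcal O(\Gamma)$, write $\Delta(e_t)=\sum_s e_s\otimes R_{st}$, and let $R_{st}(X)$ be the linear form obtained from $R_{st}\in H$ by replacing each $T^k$ by $X_{T^k}$; then $\mathcal O(U(\Gamma))=R[X_1,X_T,\dots,X_{T^{p^n-1}},1/\det(R_{st}(X))]$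 with $X_{T^t}\mapsto\sum_s X_{T^s}\otimes R_{st}(X)$. Let $i:\Gamma\to U(\Gamma)$ be the canonical embedding $X_{T^s}\mapsto T^s$, and let $q:U(\Gamma)\to U(\Gamma)/\Gamma$ be given by the inclusion into $\mathcal O(U(\Gamma))$ of the Hopf subalgebra $\mathcal O(U(\Gamma))^{\mathrm{co}\,\mathcal O(\Gamma)}=\{a:(\mathrm{id}\otimes i^\#)\Delta(a)=a\otimes1\}$. Then the two sequences of $R$-group schemes $$0\to\Gamma\xrightarrow{e}\mathcal G^{(\lambda)}\xrightarrow{F^n}\mathcal G^{(\lambda^{p^n})}\to0,\qquad 0\to\Gamma\xrightarrow{i}U(\Gamma)\xrightarrow{q}U(\Gamma)/\Gamma\to0$$ are exact (the first map is the kernel of the second, and the second is faithfully flat and of finite presentation), and: (1) $X_{T^s}\mapsto T^s$ $(0\le s\le p^n-1)$ defines a homomorphism of $R$-group schemes $\sigma_1:\mathcal G^{(\lambda)}\to U(\Gamma)$ with $\sigma_1\circ e=i$, and there is a unique homomorphism $\tau_1:\mathcal G^{(\lambda^{p^n})}\to U(\Gamma)/\Gamma$ with $\tau_1\circ F^n=q\circ\sigma_1$;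 (2) $X_1$ is invertible in $\mathcal O(U(\Gamma))$, $T\mapsto X_T/X_1$ defines a homomorphism of $R$-group schemes $\sigma_2:U(\Gamma)\to\mathcal G^{(\lambda)}$ with $\sigma_2\circ i=e$, and there is a unique homomorphism $\tau_2:U(\Gamma)/\Gamma\to\mathcal G^{(\lambda^{p^n})}$ with $\tau_2\circ q=F^n\circ\sigma_2$. -/

import Mathlib

universe u
open scoped TensorProduct Polynomial
open Coalgebra WithConv
noncomputable section
namespace GrothendieckResolution
set_option linter.unusedSectionVars false
section Coordinate
variable {R : Type u} [CommRing R]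

/-- The coordinate ring `R[T, 1/(1 + λT)]` of `𝒢^(λ)`. -/
def GAlg (lam : R) : Type u := Localization.Away (1 + Polynomial.C lam * Polynomial.X : R[X])

namespace GAlg
variable (lam : R)

instance : CommRing (GAlg lam) :=
  inferInstanceAs (CommRing (Localization.Away (1 + Polynomial.C lam * Polynomial.X : R[X])))

instance : Algebra R[X] (GAlg lam) :=
  inferInstanceAs (Algebra R[X] (Localization.Away (1 + Polynomial.C lam * Polynomial.X : R[X])))

instance : Algebra R (GAlg lam) :=
  inferInstanceAs (Algebra R (Localization.Away (1 + Polynomial.C lam * Polynomial.X : R[X])))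

instance : IsScalarTower R R[X] (GAlg lam) :=
  inferInstanceAs (IsScalarTower R R[X]
    (Localization.Away (1 + Polynomial.C lam * Polynomial.X : R[X])))

instance : IsLocalization.Away (1 + Polynomial.C lam * Polynomial.X : R[X]) (GAlg lam) :=
  inferInstanceAs (IsLocalization.Away _
    (Localization.Away (1 + Polynomial.C lam * Polynomial.X : R[X])))

/-- The coordinate `T`. -/
def T : GAlg lam := algebraMap R[X] (GAlg lam) Polynomial.X

variable {lam}

theorem isUnit_one_add : IsUnit (1 + algebraMap R (GAlg lam) lam * T lam) := by
  have := IsLocalization.Away.algebraMap_isUnit (S := GAlg lam)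
    (1 + Polynomial.C lam * Polynomial.X : R[X])
  simpa [T, IsScalarTower.algebraMap_apply R R[X] (GAlg lam)] using this

variable {A : Type*} [CommRing A] [Algebra R A]

/-- The algebra homomorphism `R[T, 1/(1 + λT)] → A` with `T ↦ a`. -/
def lift (a : A) (h : IsUnit (1 + algebraMap R A lam * a)) : GAlg lam →ₐ[R] A :=
  IsLocalization.Away.liftAlgHom (S := GAlg lam) (x := (1 + Polynomial.C lam * Polynomial.X : R[X]))
    (f := Polynomial.aeval a) (by simpa using h)

@[simp]
theorem lift_T (a : A) (h : IsUnit (1 + algebraMap R A lam * a)) : lift a h (T lam) = a := by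
  simp [lift, T]

theorem algHom_ext {f g : GAlg lam →ₐ[R] A} (h : f (T lam) = g (T lam)) : f = g := by
  apply IsLocalization.algHom_ext (Submonoid.powers (1 + Polynomial.C lam * Polynomial.X : R[X]))
  ext; exact h


variable (lam) in
/-- `T ↦ T ⊗ 1 + 1 ⊗ T + λ T ⊗ T`. -/
def comulAlgHom : GAlg lam →ₐ[R] GAlg lam ⊗[R] GAlg lam :=
  lift (T lam ⊗ₜ[R] 1 + 1 ⊗ₜ[R] T lam + lam • (T lam ⊗ₜ[R] T lam)) (by
    have h : (1 + algebraMap R (GAlg lam ⊗[R] GAlg lam) lam *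
        (T lam ⊗ₜ[R] 1 + 1 ⊗ₜ[R] T lam + lam • (T lam ⊗ₜ[R] T lam))) =
        Algebra.TensorProduct.includeLeft (R := R) (S := R)
            (1 + algebraMap R (GAlg lam) lam * T lam) *
          Algebra.TensorProduct.includeRight (1 + algebraMap R (GAlg lam) lam * T lam) := by
      simp only [map_add, map_mul, map_one, AlgHom.commutes, Algebra.smul_def,
        Algebra.TensorProduct.includeLeft_apply, Algebra.TensorProduct.includeRight_apply]
      rw [show T lam ⊗ₜ[R] T lam = (T lam ⊗ₜ[R] (1 : GAlg lam)) * ((1 : GAlg lam) ⊗ₜ[R] T lam) by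
        simp]
      ring
    rw [h]
    exact (isUnit_one_add.map _).mul (isUnit_one_add.map _))

variable (lam) in
/-- `T ↦ 0`. -/
def counitAlgHom : GAlg lam →ₐ[R] R := lift 0 (by simp)

variable (lam) in
/-- `T ↦ -T / (1 + λT)`. -/
def antipodeAlgHom : GAlg lam →ₐ[R] GAlg lam :=
  lift (-T lam * Ring.inverse (1 + algebraMap R (GAlg lam) lam * T lam)) (by
    refine IsUnit.of_mul_eq_one (1 + algebraMap R (GAlg lam) lam * T lam) ?_
    linear_combination (-algebraMap R (GAlg lam) lam * T lam) *
      Ring.inverse_mul_cancel _ (isUnit_one_add (lam := lam)))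

instance : Bialgebra R (GAlg lam) :=
  Bialgebra.ofAlgHom (comulAlgHom lam) (counitAlgHom lam)
    (algHom_ext (by
      simp [comulAlgHom, TensorProduct.add_tmul, TensorProduct.tmul_add, ← TensorProduct.smul_tmul',
        Algebra.TensorProduct.one_def]
      abel))
    (algHom_ext (by
      simp [comulAlgHom, counitAlgHom]))
    (algHom_ext (by
      simp [comulAlgHom, counitAlgHom]))

@[simp]
theorem comul_T : Coalgebra.comul (R := R) (T lam) =
    T lam ⊗ₜ[R] 1 + 1 ⊗ₜ[R] T lam + lam • (T lam ⊗ₜ[R] T lam) := by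
  change comulAlgHom lam (T lam) = _
  simp [comulAlgHom]

@[simp]
theorem counit_T : Coalgebra.counit (R := R) (T lam) = 0 := by
  change counitAlgHom lam (T lam) = _
  simp [counitAlgHom]

instance : HopfAlgebra R (GAlg lam) :=
  HopfAlgebra.ofAlgHom (antipodeAlgHom lam)
    (algHom_ext (by
      simp [antipodeAlgHom, Algebra.smul_def]
      linear_combination (-T lam) * Ring.inverse_mul_cancel _ (isUnit_one_add (lam := lam))))
    (algHom_ext (by
      simp [antipodeAlgHom, Algebra.smul_def]
      linear_combination (-T lam) * Ring.inverse_mul_cancel _ (isUnit_one_add (lam := lam))))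

end GAlg

theorem add_pow_prime_pow_of_algebra (p n : ℕ) [Fact p.Prime] [Algebra (ZMod p) R]
    {A : Type*} [CommRing A] [Algebra R A] (x y : A) :
    (x + y) ^ p ^ n = x ^ p ^ n + y ^ p ^ n := by
  obtain ⟨r, hr⟩ := exists_add_pow_prime_pow_eq (Fact.out : p.Prime) x y n
  have hp : (p : A) = 0 := by
    have h : algebraMap R A (algebraMap (ZMod p) R (p : ZMod p)) = 0 := by simp
    simpa only [map_natCast] using h
  rw [hr, hp]; ring

/-- The coordinate ring `R[T]/(T ^ (p ^ n))` of `Γ^(λ)`; its Hopf algebra structure depends on `λ`. -/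
def GammaAlg (p n : ℕ) (_lam : R) : Type u := AdjoinRoot (Polynomial.X ^ p ^ n : R[X])

namespace GammaAlg
variable (p n : ℕ) (lam : R)

instance : CommRing (GammaAlg p n lam) :=
  inferInstanceAs (CommRing (AdjoinRoot (Polynomial.X ^ p ^ n : R[X])))

instance : Algebra R (GammaAlg p n lam) :=
  inferInstanceAs (Algebra R (AdjoinRoot (Polynomial.X ^ p ^ n : R[X])))

/-- The coordinate `T`. -/
def T : GammaAlg p n lam := AdjoinRoot.root (Polynomial.X ^ p ^ n : R[X])

variable {p n lam}

theorem T_pow : T p n lam ^ p ^ n = 0 := by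
  change AdjoinRoot.root (Polynomial.X ^ p ^ n : R[X]) ^ p ^ n = 0
  rw [← AdjoinRoot.mk_X, ← map_pow, AdjoinRoot.mk_self]

section
variable {A : Type*} [CommRing A] [Algebra R A]

/-- The algebra homomorphism `R[T]/(T ^ (p ^ n)) → A` with `T ↦ a`. -/
def lift (a : A) (h : a ^ p ^ n = 0) : GammaAlg p n lam →ₐ[R] A :=
  AdjoinRoot.liftAlgHom (Polynomial.X ^ p ^ n : R[X]) (Algebra.ofId R A) a (by simpa using h)

@[simp]
theorem lift_T (a : A) (h : a ^ p ^ n = 0) : lift a h (T p n lam) = a :=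
  AdjoinRoot.liftAlgHom_root _ _ _ _

theorem algHom_ext {f g : GammaAlg p n lam →ₐ[R] A} (h : f (T p n lam) = g (T p n lam)) : f = g :=
  AdjoinRoot.algHom_ext h
end

theorem isUnit_one_add : IsUnit (1 + algebraMap R (GammaAlg p n lam) lam * T p n lam) :=
  IsNilpotent.isUnit_one_add ⟨p ^ n, by rw [mul_pow, T_pow, mul_zero]⟩

variable [Fact p.Prime] [Algebra (ZMod p) R]

variable (p n lam) in
/-- `T ↦ T ⊗ 1 + 1 ⊗ T + λ T ⊗ T`. -/
def comulAlgHom : GammaAlg p n lam →ₐ[R] GammaAlg p n lam ⊗[R] GammaAlg p n lam :=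
  lift (T p n lam ⊗ₜ[R] 1 + 1 ⊗ₜ[R] T p n lam + lam • (T p n lam ⊗ₜ[R] T p n lam)) (by
    have h0 : p ^ n ≠ 0 := pow_ne_zero _ (Fact.out : p.Prime).ne_zero
    simp [add_pow_prime_pow_of_algebra (R := R), T_pow, smul_pow])

variable (p n lam) in
/-- `T ↦ 0`. -/
def counitAlgHom : GammaAlg p n lam →ₐ[R] R :=
  lift 0 (by simp [(Fact.out : p.Prime).ne_zero])

variable (p n lam) in
/-- `T ↦ -T / (1 + λT)`. -/
def antipodeAlgHom : GammaAlg p n lam →ₐ[R] GammaAlg p n lam :=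
  lift (-T p n lam * Ring.inverse (1 + algebraMap R (GammaAlg p n lam) lam * T p n lam)) (by
    rw [mul_pow, neg_pow, T_pow]; simp)

instance : Bialgebra R (GammaAlg p n lam) :=
  Bialgebra.ofAlgHom (comulAlgHom p n lam) (counitAlgHom p n lam)
    (algHom_ext (by
      simp [comulAlgHom, TensorProduct.add_tmul, TensorProduct.tmul_add, ← TensorProduct.smul_tmul',
        Algebra.TensorProduct.one_def]
      abel))
    (algHom_ext (by
      simp [comulAlgHom, counitAlgHom]))
    (algHom_ext (by
      simp [comulAlgHom, counitAlgHom]))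

@[simp]
theorem comul_T : Coalgebra.comul (R := R) (T p n lam) =
    T p n lam ⊗ₜ[R] 1 + 1 ⊗ₜ[R] T p n lam + lam • (T p n lam ⊗ₜ[R] T p n lam) := by
  change comulAlgHom p n lam (T p n lam) = _
  simp [comulAlgHom]

@[simp]
theorem counit_T : Coalgebra.counit (R := R) (T p n lam) = 0 := by
  change counitAlgHom p n lam (T p n lam) = _
  simp [counitAlgHom]

instance : HopfAlgebra R (GammaAlg p n lam) :=
  HopfAlgebra.ofAlgHom (antipodeAlgHom p n lam)
    (algHom_ext (by
      simp [antipodeAlgHom, Algebra.smul_def]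
      linear_combination (-T p n lam) *
        Ring.inverse_mul_cancel _ (isUnit_one_add (p := p) (n := n) (lam := lam))))
    (algHom_ext (by
      simp [antipodeAlgHom, Algebra.smul_def]
      linear_combination (-T p n lam) *
        Ring.inverse_mul_cancel _ (isUnit_one_add (p := p) (n := n) (lam := lam))))

instance : Coalgebra.IsCocomm R (GammaAlg p n lam) where
  comm_comp_comul := by
    have h : (Algebra.TensorProduct.comm R (GammaAlg p n lam) (GammaAlg p n lam)).toAlgHom.comp
        (comulAlgHom p n lam) = comulAlgHom p n lam :=
      algHom_ext (by simp [comulAlgHom]; abel)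
    exact congr(($h).toLinearMap)

end GammaAlg

/-- The basis `1, T, …, T ^ (N - 1)` of `R[T]/(T ^ N)` (also over the zero ring). -/
def truncBasis (R : Type u) [CommRing R] (N : ℕ) :
    Module.Basis (Fin N) R (AdjoinRoot (Polynomial.X ^ N : R[X])) :=
  .ofEquivFun
    { toFun := fun f i => (AdjoinRoot.modByMonicHom (Polynomial.monic_X_pow N) f).coeff i
      map_add' := fun f g => funext fun i => by
        simp only [map_add, Polynomial.coeff_add, Pi.add_apply]
      map_smul' := fun r f => funext fun i => by
        simp only [map_smul, Polynomial.coeff_smul, Pi.smul_apply, RingHom.id_apply]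
      invFun := fun c => AdjoinRoot.mk _ (∑ i : Fin N, Polynomial.monomial i (c i))
      left_inv := fun f => AdjoinRoot.induction_on _ f fun f => Eq.symm <|
        AdjoinRoot.mk_eq_mk.mpr <| by
          simp only [AdjoinRoot.modByMonicHom_mk,
            Polynomial.sum_modByMonic_coeff (Polynomial.monic_X_pow N)
              (Polynomial.degree_X_pow_le N)]
          rw [Polynomial.modByMonic_eq_sub_mul_div, sub_sub_cancel]
          exact dvd_mul_right _ _
      right_inv := fun c => funext fun i => by
        nontriviality R
        simp only [AdjoinRoot.modByMonicHom_mk]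
        rw [(Polynomial.modByMonic_eq_self_iff (Polynomial.monic_X_pow N)).mpr,
          Polynomial.finsetSum_coeff]
        · simp_rw [Polynomial.coeff_monomial, Fin.val_eq_val]
          rw [Finset.sum_ite_eq' Finset.univ i, if_pos (Finset.mem_univ i)]
        · simp_rw [← Polynomial.C_mul_X_pow_eq_monomial]
          rw [Polynomial.degree_X_pow]
          exact Polynomial.degree_sum_fin_lt _ }

theorem truncBasis_apply (N : ℕ) (s : Fin N) :
    truncBasis R N s = AdjoinRoot.root (Polynomial.X ^ N : R[X]) ^ (s : ℕ) := by
  rw [truncBasis, Module.Basis.coe_ofEquivFun]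
  change AdjoinRoot.mk _ (∑ i : Fin N, Polynomial.monomial i
    ((Pi.single s 1 : Fin N → R) i)) = AdjoinRoot.root _ ^ (s : ℕ)
  rw [← AdjoinRoot.mk_X, ← map_pow, Finset.sum_eq_single s]
  · simp [Polynomial.X_pow_eq_monomial]
  · intro i _ hi; simp [hi]
  · simp

/-- The basis `1, T, …, T ^ (p ^ n - 1)` of the coordinate ring of `Γ^(λ)`. -/
def GammaAlg.basis (p n : ℕ) (lam : R) : Module.Basis (Fin (p ^ n)) R (GammaAlg p n lam) :=
  truncBasis R (p ^ n)

theorem GammaAlg.basis_apply (p n : ℕ) (lam : R) (s : Fin (p ^ n)) :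
    GammaAlg.basis p n lam s = GammaAlg.T p n lam ^ (s : ℕ) :=
  truncBasis_apply (p ^ n) s

end Coordinate

section UnitGroup
variable {R : Type*} [CommRing R] {H : Type*} [CommRing H] [HopfAlgebra R H]
  {ι : Type*} [Fintype ι] [DecidableEq ι] (b : Module.Basis ι R H)

/-- The elements `R_ij` of `H` defined by `Δ e_j = ∑ i, e_i ⊗ R_ij`. -/
def regCoeff (i j : ι) : H := TensorProduct.lid R H ((b.coord i).rTensor H (comul (b j)))

theorem sum_tmul_regCoeff (j : ι) : ∑ i, b i ⊗ₜ[R] regCoeff b i j = comul (b j) := by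
  have key : ∀ x : H ⊗[R] H,
      ∑ i, b i ⊗ₜ[R] (TensorProduct.lid R H ((b.coord i).rTensor H x)) = x := by
    intro x
    induction x with
    | zero => simp
    | add x y hx hy => simp only [map_add, TensorProduct.tmul_add, Finset.sum_add_distrib, hx, hy]
    | tmul x y =>
      simp only [LinearMap.rTensor_tmul, TensorProduct.lid_tmul, ← TensorProduct.smul_tmul,
        ← TensorProduct.sum_tmul, Module.Basis.coord_apply, b.sum_repr]
  exact key _

variable {A : Type*} [CommRing A] [Algebra R A]

/-- The matrix `(f (R_ij))` attached to a linear map `f : H → A`, i.e. to a point of the group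
algebra scheme `A(Γ)`, `Γ = Spec H`. -/
def regMatrix (f : H →ₗ[R] A) : Matrix ι ι A := Matrix.of fun i j => f (regCoeff b i j)

theorem convMul_basis (f g : WithConv (H →ₗ[R] A)) (j : ι) :
    (f * g) (b j) = ∑ i, f (b i) * g (regCoeff b i j) := by
  rw [LinearMap.convMul_apply, ← sum_tmul_regCoeff]
  simp

theorem comul_regCoeff (i j : ι) :
    comul (R := R) (regCoeff b i j) = ∑ k, regCoeff b i k ⊗ₜ[R] regCoeff b k j := by
  have h := Coalgebra.coassoc_apply (R := R) (b j)
  rw [← sum_tmul_regCoeff] at h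
  simp only [map_sum, LinearMap.rTensor_tmul, LinearMap.lTensor_tmul] at h
  have h2 := congr(TensorProduct.lid R (H ⊗[R] H) ((b.coord i).rTensor (H ⊗[R] H) $h))
  simp only [← sum_tmul_regCoeff, TensorProduct.sum_tmul, map_sum, TensorProduct.assoc_tmul,
    LinearMap.rTensor_tmul, TensorProduct.lid_tmul, Module.Basis.coord_apply,
    Module.Basis.repr_self, Finsupp.single_apply, ite_smul, one_smul, zero_smul,
    Finset.sum_ite_eq', Finset.mem_univ, if_true] at h2
  simpa using h2.symm

theorem counit_regCoeff (i j : ι) :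
    counit (R := R) (regCoeff b i j) = if i = j then 1 else 0 := by
  have h := Coalgebra.lTensor_counit_comul (R := R) (b j)
  rw [← sum_tmul_regCoeff] at h
  have h2 := congr(b.coord i (TensorProduct.rid R H $h))
  simpa [Finsupp.single_apply, eq_comm] using h2

theorem regMatrix_mul (f g : WithConv (H →ₗ[R] A)) :
    regMatrix b (f * g).ofConv = regMatrix b f.ofConv * regMatrix b g.ofConv := by
  ext i j
  simp [regMatrix, Matrix.mul_apply, LinearMap.convMul_def, comul_regCoeff]

theorem regMatrix_one : regMatrix b (1 : WithConv (H →ₗ[R] A)).ofConv = 1 := by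
  ext i j
  simp [regMatrix, LinearMap.convOne_def, counit_regCoeff, Matrix.one_apply]

theorem isUnit_det_regMatrix {f : WithConv (H →ₗ[R] A)} (h : IsUnit f) :
    IsUnit (regMatrix b f.ofConv).det := by
  obtain ⟨g, hg⟩ := h.exists_right_inv
  refine IsUnit.of_mul_eq_one (regMatrix b g.ofConv).det ?_
  rw [← Matrix.det_mul, ← regMatrix_mul, hg, regMatrix_one, Matrix.det_one]

theorem isUnit_of_det [IsCocomm R H] {f : H →ₗ[R] A} (h : IsUnit (regMatrix b f).det) :
    IsUnit (toConv f) := by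
  let g : H →ₗ[R] A := b.constr R fun i =>
    ∑ k, algebraMap R A (counit (b k)) * (regMatrix b f)⁻¹ k i
  refine IsUnit.of_mul_eq_one_right (toConv g) ?_
  apply WithConv.ext
  refine b.ext fun j => ?_
  change (toConv g * toConv f) (b j) = _
  rw [convMul_basis]
  have h2 : ∀ i, g (b i) = ∑ k, algebraMap R A (counit (b k)) * (regMatrix b f)⁻¹ k i := by
    intro i; simp [g]
  simp only [h2, Finset.sum_mul]
  rw [Finset.sum_comm]
  have h3 : ∀ k, ∑ i, (regMatrix b f)⁻¹ k i * f (regCoeff b i j) = (1 : Matrix ι ι A) k j := by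
    intro k
    rw [← Matrix.nonsing_inv_mul _ h, Matrix.mul_apply]
    rfl
  simp only [mul_assoc, ← Finset.mul_sum, h3, Matrix.one_apply]
  simp

end UnitGroup

section Conv
variable {R : Type*} [CommRing R] {C : Type*} [AddCommGroup C] [Module R C] [Coalgebra R C]
  {D : Type*} [AddCommGroup D] [Module R D] [Coalgebra R D]
  {A : Type*} [CommRing A] [Algebra R A] {B : Type*} [CommRing B] [Algebra R B]

/-- Composition with an algebra homomorphism, on convolution monoids. -/
def convPost (φ : A →ₐ[R] B) : WithConv (C →ₗ[R] A) →* WithConv (C →ₗ[R] B) where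
  toFun f := toConv (φ.toLinearMap ∘ₗ f.ofConv)
  map_one' := by
    apply WithConv.ext; ext x; simp [LinearMap.convOne_def]
  map_mul' f g := by
    apply WithConv.ext; exact LinearMap.algHom_comp_convMul_distrib φ f g

/-- Composition with a coalgebra homomorphism, on convolution monoids. -/
def convPre (h : D →ₗc[R] C) : WithConv (C →ₗ[R] A) →* WithConv (D →ₗ[R] A) where
  toFun f := toConv (f.ofConv ∘ₗ h.toLinearMap)
  map_one' := by
    apply WithConv.ext; ext x; simp [LinearMap.convOne_def]
  map_mul' f g := by
    apply WithConv.ext; exact LinearMap.convMul_comp_coalgHom_distrib f g h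

end Conv

section UAlg
universe v w
variable {R : Type u} [CommRing R] {H : Type v} [CommRing H] [HopfAlgebra R H]
  {ι : Type w} [Fintype ι] [DecidableEq ι] (b : Module.Basis ι R H)

/-- `det (R_ij(X))`, where the linear forms `R_ij` in the basis are evaluated at the variables. -/
def regDet : MvPolynomial ι R := (regMatrix b (b.constr R (MvPolynomial.X (R := R)))).det

/-- For `Γ = Spec H` with `H` free with basis `(e_i)`, the coordinate ring
`R[X_i, 1/det (R_ij(X))]` of the unit group scheme `U(Γ) : A ↦ Hom_R(H, A)ˣ` (the units of the
convolution algebra). -/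
def UAlg : Type (max u w) := Localization.Away (regDet b)

namespace UAlg

instance : CommRing (UAlg b) := inferInstanceAs (CommRing (Localization.Away (regDet b)))
instance : Algebra (MvPolynomial ι R) (UAlg b) :=
  inferInstanceAs (Algebra (MvPolynomial ι R) (Localization.Away (regDet b)))
instance : Algebra R (UAlg b) := inferInstanceAs (Algebra R (Localization.Away (regDet b)))
instance : IsScalarTower R (MvPolynomial ι R) (UAlg b) :=
  inferInstanceAs (IsScalarTower R (MvPolynomial ι R) (Localization.Away (regDet b)))
instance : IsLocalization.Away (regDet b) (UAlg b) :=
  inferInstanceAs (IsLocalization.Away (regDet b) (Localization.Away (regDet b)))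

/-- The coordinate `X_{e_i}`. -/
def X (i : ι) : UAlg b := algebraMap (MvPolynomial ι R) (UAlg b) (MvPolynomial.X i)

/-- The universal linear map `e_i ↦ X_{e_i}`. -/
def univ : H →ₗ[R] UAlg b := b.constr R (X b)

@[simp] theorem univ_basis (i : ι) : univ b (b i) = X b i := by simp [univ]

variable {A : Type*} [CommRing A] [Algebra R A]

theorem map_regDet (φ : MvPolynomial ι R →ₐ[R] A) :
    φ (regDet b) = (regMatrix b (b.constr R fun i => φ (MvPolynomial.X i))).det := by
  rw [regDet, AlgHom.map_det]
  congr 1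
  ext i j
  have : φ.toLinearMap ∘ₗ b.constr R (MvPolynomial.X (R := R)) =
      b.constr R fun i => φ (MvPolynomial.X i) := b.ext fun i => by simp
  exact congr($this _)

theorem isUnit_univ [IsCocomm R H] : IsUnit (toConv (univ b)) := by
  apply isUnit_of_det b
  have h := IsLocalization.Away.algebraMap_isUnit (S := UAlg b) (regDet b)
  have h2 := map_regDet b (IsScalarTower.toAlgHom R (MvPolynomial ι R) (UAlg b))
  have h3 : IsUnit (IsScalarTower.toAlgHom R (MvPolynomial ι R) (UAlg b) (regDet b)) := h
  rw [h2] at h3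
  exact h3

/-- The algebra homomorphism defined by a convolution-invertible linear map `f : H → A`. -/
def lift (f : H →ₗ[R] A) (hf : IsUnit (toConv f)) : UAlg b →ₐ[R] A :=
  IsLocalization.Away.liftAlgHom (S := UAlg b) (x := regDet b)
    (f := MvPolynomial.aeval fun i => f (b i)) (by
      rw [map_regDet]
      have : (b.constr R fun i => MvPolynomial.aeval (R := R) (fun i => f (b i)) (MvPolynomial.X i)) = f :=
        b.ext fun i => by simp
      rw [this]
      exact isUnit_det_regMatrix b hf)

@[simp]
theorem lift_X (f : H →ₗ[R] A) (hf : IsUnit (toConv f)) (i : ι) : lift b f hf (X b i) = f (b i) := by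
  simp [lift, X]

theorem lift_comp_univ (f : H →ₗ[R] A) (hf : IsUnit (toConv f)) :
    (lift b f hf).toLinearMap ∘ₗ univ b = f :=
  b.ext fun i => by simp

@[simp]
theorem lift_univ (f : H →ₗ[R] A) (hf : IsUnit (toConv f)) (h : H) : lift b f hf (univ b h) = f h :=
  congr($(lift_comp_univ b f hf) h)

variable {b} in
theorem algHom_ext {f g : UAlg b →ₐ[R] A}
    (h : f.toLinearMap ∘ₗ univ b = g.toLinearMap ∘ₗ univ b) : f = g := by
  apply IsLocalization.algHom_ext (Submonoid.powers (regDet b))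
  ext i
  have := congr($h (b i))
  simp only [LinearMap.comp_apply, univ_basis] at this
  exact this

variable [IsCocomm R H]

theorem isUnit_comul : IsUnit (toConv (TensorProduct.map (univ b) (univ b) ∘ₗ comul (R := R))) := by
  have h : toConv (TensorProduct.map (univ b) (univ b) ∘ₗ comul (R := R)) =
      convPost (Algebra.TensorProduct.includeLeft (R := R) (S := R)) (toConv (univ b)) *
      convPost (Algebra.TensorProduct.includeRight) (toConv (univ b)) := by
    apply WithConv.ext
    ext x
    simp only [LinearMap.convMul_def, LinearMap.comp_apply]
    generalize comul (R := R) x = y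
    induction y with
    | zero => simp
    | add y z hy hz => simp only [map_add, hy, hz]
    | tmul y z => simp [convPost]
  rw [h]
  exact ((isUnit_univ b).map _).mul ((isUnit_univ b).map _)

/-- `X_{e_j} ↦ ∑ i, X_{e_i} ⊗ R_ij(X)`. -/
def comulAlgHom : UAlg b →ₐ[R] UAlg b ⊗[R] UAlg b :=
  lift b (TensorProduct.map (univ b) (univ b) ∘ₗ comul) (isUnit_comul b)

/-- `X_{e_i} ↦ ε(e_i)`. -/
def counitAlgHom : UAlg b →ₐ[R] R :=
  lift b counit (by
    have : toConv (counit (R := R) (A := H)) = 1 := rfl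
    rw [this]; exact isUnit_one)

/-- The antipode, given by the convolution inverse of the universal linear map. -/
def antipodeAlgHom : UAlg b →ₐ[R] UAlg b :=
  lift b (Ring.inverse (toConv (univ b))).ofConv (by
    rw [toConv_ofConv]; exact (isUnit_univ b).ringInverse)

theorem comulAlgHom_univ (h : H) :
    comulAlgHom b (univ b h) = TensorProduct.map (univ b) (univ b) (comul h) :=
  congr($(lift_comp_univ b _ (isUnit_comul b)) h)

theorem counitAlgHom_univ (h : H) : counitAlgHom b (univ b h) = counit h := by
  simp [counitAlgHom]

instance : Bialgebra R (UAlg b) :=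
  Bialgebra.ofAlgHom (comulAlgHom b) (counitAlgHom b)
    (algHom_ext (by
      ext x
      change TensorProduct.assoc R _ _ _ (Algebra.TensorProduct.map (comulAlgHom b)
        (.id R (UAlg b)) (comulAlgHom b (univ b x))) = Algebra.TensorProduct.map
        (.id R (UAlg b)) (comulAlgHom b) (comulAlgHom b (univ b x))
      rw [comulAlgHom_univ]
      have hc := congr(TensorProduct.map (univ b) (TensorProduct.map (univ b) (univ b))
        $(Coalgebra.coassoc_apply (R := R) x))
      refine Eq.trans ?_ (hc.trans ?_)
      · generalize comul (R := R) x = y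
        induction y with
        | zero => simp
        | add y z hy hz => simp only [map_add, hy, hz]
        | tmul y z =>
          simp only [TensorProduct.map_tmul, Algebra.TensorProduct.map_tmul, comulAlgHom_univ,
            LinearMap.rTensor_tmul]
          generalize comul (R := R) y = t
          induction t with
          | zero => simp
          | add t s ht hs => simp only [map_add, TensorProduct.add_tmul, ht, hs]
          | tmul t s => simp
      · generalize comul (R := R) x = y
        induction y with
        | zero => simp
        | add y z hy hz => simp only [map_add, hy, hz]
        | tmul y z => simp [comulAlgHom_univ]))
    (algHom_ext (by
      ext x
      change Algebra.TensorProduct.map (counitAlgHom b) (.id R (UAlg b))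
        (comulAlgHom b (univ b x)) = 1 ⊗ₜ univ b x
      have h := congr(TensorProduct.map LinearMap.id (univ b)
        $(Coalgebra.rTensor_counit_comul (R := R) x))
      rw [comulAlgHom_univ]
      refine Eq.trans ?_ h
      generalize comul (R := R) x = y
      induction y with
      | zero => simp
      | add y z hy hz => simp only [map_add, hy, hz]
      | tmul y z => simp [counitAlgHom_univ]))
    (algHom_ext (by
      ext x
      change Algebra.TensorProduct.map (.id R (UAlg b)) (counitAlgHom b)
        (comulAlgHom b (univ b x)) = univ b x ⊗ₜ 1
      have h := congr(TensorProduct.map (univ b) LinearMap.id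
        $(Coalgebra.lTensor_counit_comul (R := R) x))
      rw [comulAlgHom_univ]
      refine Eq.trans ?_ h
      generalize comul (R := R) x = y
      induction y with
      | zero => simp
      | add y z hy hz => simp only [map_add, hy, hz]
      | tmul y z => simp [counitAlgHom_univ]))

theorem comul_univ (h : H) : comul (R := R) (univ b h) =
    TensorProduct.map (univ b) (univ b) (comul h) := comulAlgHom_univ b h

theorem counit_univ (h : H) : counit (R := R) (univ b h) = counit h :=
  counitAlgHom_univ b h

theorem lift_comp_comul (f g : UAlg b →ₐ[R] A) :
    toConv (((Algebra.TensorProduct.lift f g fun _ _ => Commute.all _ _).comp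
      (Bialgebra.comulAlgHom R (UAlg b))).toLinearMap ∘ₗ univ b) =
    toConv (f.toLinearMap ∘ₗ univ b) * toConv (g.toLinearMap ∘ₗ univ b) := by
  apply WithConv.ext
  ext x
  simp only [LinearMap.convMul_def, LinearMap.comp_apply, AlgHom.toLinearMap_apply,
    AlgHom.comp_apply, Bialgebra.comulAlgHom_apply, comul_univ]
  generalize comul (R := R) x = y
  induction y with
  | zero => simp
  | add y z hy hz => simp only [map_add, hy, hz]
  | tmul y z => simp

theorem ofId_comp_counit : toConv (((Algebra.ofId R A).comp
    (Bialgebra.counitAlgHom R (UAlg b))).toLinearMap ∘ₗ univ b) = 1 := by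
  apply WithConv.ext
  ext x
  simp [LinearMap.convOne_def, counit_univ, Algebra.ofId_apply]

instance : HopfAlgebra R (UAlg b) :=
  HopfAlgebra.ofAlgHom (antipodeAlgHom b)
    (algHom_ext (toConv_injective (by
      rw [lift_comp_comul, ofId_comp_counit, antipodeAlgHom, lift_comp_univ, toConv_ofConv]
      exact Ring.inverse_mul_cancel _ (isUnit_univ b))))
    (algHom_ext (toConv_injective (by
      rw [lift_comp_comul, ofId_comp_counit, antipodeAlgHom, lift_comp_univ, toConv_ofConv]
      exact Ring.mul_inverse_cancel _ (isUnit_univ b))))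

instance : IsCocomm R (UAlg b) where
  comm_comp_comul := by
    have h : (Algebra.TensorProduct.comm R (UAlg b) (UAlg b)).toAlgHom.comp
        (comulAlgHom b) = comulAlgHom b :=
      algHom_ext (by
        ext x
        change TensorProduct.comm R (UAlg b) (UAlg b) (comulAlgHom b (univ b x)) =
          comulAlgHom b (univ b x)
        simp only [comulAlgHom, lift_univ, LinearMap.comp_apply]
        rw [← TensorProduct.map_comm, Coalgebra.comm_comul])
    exact congr(($h).toLinearMap)

theorem isUnit_id : IsUnit (toConv (LinearMap.id (R := R) (M := H))) :=
  IsUnit.of_mul_eq_one (toConv (HopfAlgebra.antipode R)) LinearMap.id_mul_antipode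

/-- The Hopf algebra map `X_{e_i} ↦ e_i` of the canonical embedding `Γ → U(Γ)`. -/
def toGroup : UAlg b →ₐc[R] H :=
  .ofAlgHom (lift b LinearMap.id isUnit_id)
    (algHom_ext (by
      ext x
      simp [counit_univ]))
    (algHom_ext (by
      ext x
      simp only [LinearMap.comp_apply, AlgHom.toLinearMap_apply,
        AlgHom.comp_apply, Bialgebra.comulAlgHom_apply, comul_univ, lift_univ, LinearMap.id_apply]
      generalize comul (R := R) x = y
      induction y with
      | zero => simp
      | add y z hy hz => simp only [map_add, hy, hz]
      | tmul y z => simp))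

@[simp] theorem toGroup_univ (h : H) : toGroup b (univ b h) = h :=
  lift_univ b LinearMap.id isUnit_id h
end UAlg
end UAlg


section SubHopf
variable {R : Type*} [CommRing R] {A : Type*} [CommRing A] [HopfAlgebra R A] (C : Subalgebra R A)
  (h₂ : Function.Injective (Algebra.TensorProduct.map C.val C.val))
  (hΔ : ∀ c : C, comul (R := R) (c : A) ∈ (Algebra.TensorProduct.map C.val C.val).range)
  (hS : ∀ c : C, HopfAlgebra.antipode R (c : A) ∈ C)

/-- The comultiplication of `A` restricted to `C`. -/
def subComul : C →ₐ[R] C ⊗[R] C :=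
  (AlgEquiv.ofInjective (Algebra.TensorProduct.map C.val C.val) h₂).symm.toAlgHom.comp
    (((Bialgebra.comulAlgHom R A).comp C.val).codRestrict _ hΔ)

theorem map_subComul (c : C) :
    Algebra.TensorProduct.map C.val C.val (subComul C h₂ hΔ c) = comul (R := R) (c : A) := by
  have h := (AlgEquiv.ofInjective (Algebra.TensorProduct.map C.val C.val) h₂).apply_symm_apply
    (((Bialgebra.comulAlgHom R A).comp C.val).codRestrict _ hΔ c)
  exact congr(Subtype.val $h)

theorem subComul_coassoc
    (h₃ : Function.Injective
      (Algebra.TensorProduct.map C.val (Algebra.TensorProduct.map C.val C.val))) (c : C) :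
    Algebra.TensorProduct.assoc R R R C C C (Algebra.TensorProduct.map (subComul C h₂ hΔ)
      (.id R C) (subComul C h₂ hΔ c)) =
    Algebra.TensorProduct.map (.id R C) (subComul C h₂ hΔ) (subComul C h₂ hΔ c) := by
  apply h₃
  have hc := Coalgebra.coassoc_apply (R := R) (c : A)
  rw [← map_subComul C h₂ hΔ] at hc
  refine Eq.trans ?_ (hc.trans ?_)
  · generalize subComul C h₂ hΔ c = y
    induction y with
    | zero => simp
    | add y z hy hz => simp only [map_add, hy, hz]
    | tmul y z =>
      simp only [Algebra.TensorProduct.map_tmul, LinearMap.rTensor_tmul, Subalgebra.coe_val,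
        ← map_subComul C h₂ hΔ, AlgHom.coe_id, id_eq]
      generalize subComul C h₂ hΔ y = t
      induction t with
      | zero => simp
      | add t s ht hs => simp only [map_add, TensorProduct.add_tmul, ht, hs]
      | tmul t s => simp
  · generalize subComul C h₂ hΔ c = y
    induction y with
    | zero => simp
    | add y z hy hz => simp only [map_add, hy, hz]
    | tmul y z => simp [map_subComul]

variable (h₃ : Function.Injective
    (Algebra.TensorProduct.map C.val (Algebra.TensorProduct.map C.val C.val)))

/-- A subalgebra stable under the structure maps, as a bialgebra. -/
abbrev subBialgebra : Bialgebra R C :=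
  Bialgebra.ofAlgHom (subComul C h₂ hΔ) ((Bialgebra.counitAlgHom R A).comp C.val)
    (AlgHom.ext fun c => subComul_coassoc C h₂ hΔ h₃ c)
    (AlgHom.ext fun c => by
      have h := Coalgebra.rTensor_counit_comul (R := R) (c : A)
      rw [← map_subComul C h₂ hΔ] at h
      have h' := congr(TensorProduct.lid R A $h)
      apply (TensorProduct.lid R C).injective
      apply Subtype.val_injective
      refine Eq.trans ?_ (h'.trans ?_)
      · simp only [AlgHom.comp_apply]
        generalize subComul C h₂ hΔ c = y
        induction y with
        | zero => simp
        | add y z hy hz => simp only [map_add, Subalgebra.coe_add, hy, hz]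
        | tmul y z => simp
      · simp)
    (AlgHom.ext fun c => by
      have h := Coalgebra.lTensor_counit_comul (R := R) (c : A)
      rw [← map_subComul C h₂ hΔ] at h
      have h' := congr(TensorProduct.rid R A $h)
      apply (TensorProduct.rid R C).injective
      apply Subtype.val_injective
      refine Eq.trans ?_ (h'.trans ?_)
      · simp only [AlgHom.comp_apply]
        generalize subComul C h₂ hΔ c = y
        induction y with
        | zero => simp
        | add y z hy hz => simp only [map_add, Subalgebra.coe_add, hy, hz]
        | tmul y z => simp
      · simp)

/-- A subalgebra stable under the structure maps, as a Hopf algebra. -/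
abbrev subHopf : HopfAlgebra R C :=
  letI := subBialgebra C h₂ hΔ h₃
  HopfAlgebra.ofAlgHom (((HopfAlgebra.antipodeAlgHom R A).comp C.val).codRestrict C hS)
    (AlgHom.ext fun c => by
      have h := HopfAlgebra.mul_antipode_rTensor_comul_apply (R := R) (c : A)
      rw [← map_subComul C h₂ hΔ] at h
      apply Subtype.val_injective
      refine Eq.trans ?_ (h.trans ?_)
      · change ((Algebra.TensorProduct.lift _ _ (fun _ _ => Commute.all _ _)
          (subComul C h₂ hΔ c) : C) : A) = _
        generalize subComul C h₂ hΔ c = y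
        induction y with
        | zero => simp
        | add y z hy hz => simp only [map_add, Subalgebra.coe_add, hy, hz]
        | tmul y z => simp; rfl
      · rfl)
    (AlgHom.ext fun c => by
      have h := HopfAlgebra.mul_antipode_lTensor_comul_apply (R := R) (c : A)
      rw [← map_subComul C h₂ hΔ] at h
      apply Subtype.val_injective
      refine Eq.trans ?_ (h.trans ?_)
      · change ((Algebra.TensorProduct.lift _ _ (fun _ _ => Commute.all _ _)
          (subComul C h₂ hΔ c) : C) : A) = _
        generalize subComul C h₂ hΔ c = y
        induction y with
        | zero => simp
        | add y z hy hz => simp only [map_add, Subalgebra.coe_add, hy, hz]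
        | tmul y z => simp; rfl
      · rfl)

end SubHopf

section Coinvariants
variable {R : Type*} [CommRing R] {A : Type*} [CommRing A] [HopfAlgebra R A]
  {H : Type*} [CommRing H] [HopfAlgebra R H] (π : A →ₐc[R] H)

/-- The right coaction `(id ⊗ π) ∘ Δ` of `H` on `A`. -/
def coaction : A →ₐ[R] A ⊗[R] H :=
  (Algebra.TensorProduct.map (.id R A) (π : A →ₐ[R] H)).comp (Bialgebra.comulAlgHom R A)

/-- The subalgebra `A^{co H}` of all `a` with `(id ⊗ π)(Δ a) = a ⊗ 1`. -/
def coinvariants : Subalgebra R A :=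
  AlgHom.equalizer (coaction π) Algebra.TensorProduct.includeLeft

theorem mem_coinvariants {a : A} : a ∈ coinvariants π ↔ coaction π a = a ⊗ₜ 1 := Iff.rfl

theorem conv_apply_coinvariant {B : Type*} [CommRing B] [Algebra R B] (f : A →ₗ[R] B)
    (g : WithConv (H →ₗ[R] B)) {c : A} (hc : c ∈ coinvariants π) :
    (toConv f * convPre (π : A →ₗc[R] H) g).ofConv c = f c * g.ofConv 1 := by
  have h : (toConv f * convPre (π : A →ₗc[R] H) g).ofConv c =
      LinearMap.mul' R B (TensorProduct.map f g.ofConv (coaction π c)) := by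
    simp only [LinearMap.convMul_def, LinearMap.comp_apply, coaction, AlgHom.comp_apply,
      Bialgebra.comulAlgHom_apply]
    generalize comul (R := R) c = y
    induction y with
    | zero => simp
    | add y z hy hz => simp only [map_add, hy, hz]
    | tmul y z => simp [convPre]
  rw [h, (mem_coinvariants π).1 hc]
  simp

theorem coaction_eq : toConv (coaction π).toLinearMap =
    convPost (Algebra.TensorProduct.includeLeft (R := R) (S := R)) (toConv LinearMap.id) *
    convPre (π : A →ₗc[R] H)
      (toConv (Algebra.TensorProduct.includeRight (R := R) (A := A) (B := H)).toLinearMap) := by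
  apply WithConv.ext
  ext x
  simp only [LinearMap.convMul_def, LinearMap.comp_apply, coaction, AlgHom.comp_apply,
      Bialgebra.comulAlgHom_apply, AlgHom.toLinearMap_apply]
  generalize comul (R := R) x = y
  induction y with
  | zero => simp
  | add y z hy hz => simp only [map_add, hy, hz]
  | tmul y z => simp [convPre, convPost]

theorem comul_eq : toConv (comul (R := R) (A := A)) =
    convPost (Algebra.TensorProduct.includeLeft (R := R) (S := R)) (toConv LinearMap.id) *
    convPost (Algebra.TensorProduct.includeRight (R := R)) (toConv LinearMap.id) := by
  apply WithConv.ext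
  ext x
  simp only [LinearMap.convMul_def, LinearMap.comp_apply]
  generalize comul (R := R) x = y
  induction y with
  | zero => simp
  | add y z hy hz => rw [map_add, map_add, ← hy, ← hz]
  | tmul y z =>
    exact (by simp : y ⊗ₜ[R] z = (y ⊗ₜ[R] (1 : A)) * ((1 : A) ⊗ₜ[R] z))

end Coinvariants


section Quotient
variable {R : Type u} [CommRing R] {H : Type*} [CommRing H] [HopfAlgebra R H] [IsCocomm R H]
  {ι : Type*} [Fintype ι] [DecidableEq ι] (b : Module.Basis ι R H)

namespace UAlg

/-- The convolution inverse of the universal linear map. -/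
def univInv : WithConv (H →ₗ[R] UAlg b) := Ring.inverse (toConv (univ b))

theorem univ_mul_univInv : toConv (univ b) * univInv b = 1 :=
  Ring.mul_inverse_cancel _ (isUnit_univ b)

theorem univ_one_mul : univ b 1 * (univInv b).ofConv 1 = 1 := by
  have h := congr(($(univ_mul_univInv b)).ofConv 1)
  simpa [LinearMap.convMul_def, LinearMap.convOne_def, Algebra.TensorProduct.one_def] using h

/-- The map `a ↦ ∑ a₀ ψ⁻¹(a₁)`, with `ψ` the universal linear map. -/
def proj : WithConv (UAlg b →ₗ[R] UAlg b) :=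
  toConv LinearMap.id * convPre (toGroup b : UAlg b →ₗc[R] H) (univInv b)

theorem coaction_univ : toConv ((coaction (toGroup b)).toLinearMap ∘ₗ univ b) =
    convPost (Algebra.TensorProduct.includeLeft (R := R) (S := R)) (toConv (univ b)) *
    toConv (Algebra.TensorProduct.includeRight (R := R) (A := UAlg b) (B := H)).toLinearMap := by
  apply WithConv.ext
  ext x
  simp only [LinearMap.convMul_def, LinearMap.comp_apply, coaction, AlgHom.comp_apply,
      Bialgebra.comulAlgHom_apply, AlgHom.toLinearMap_apply, comul_univ]
  generalize comul (R := R) x = y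
  induction y with
  | zero => simp
  | add y z hy hz => simp only [map_add, hy, hz]
  | tmul y z => simp [convPost]

theorem proj_mem (a : UAlg b) : (proj b).ofConv a ∈ coinvariants (toGroup b) := by
  rw [mem_coinvariants]
  let π : UAlg b →ₗc[R] H := (toGroup b : UAlg b →ₗc[R] H)
  let L := Algebra.TensorProduct.includeLeft (R := R) (S := R) (A := UAlg b) (B := H)
  let y := convPre (A := UAlg b ⊗[R] H) π
    (toConv (Algebra.TensorProduct.includeRight (R := R) (A := UAlg b) (B := H)).toLinearMap)
  let w := convPre π (toConv (univ b))
  let w' := convPre π (univInv b)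
  have hw : w * w' = 1 := by
    simp only [w, w', ← map_mul, univ_mul_univInv, map_one]
  have h1 : convPost (coaction (toGroup b)) w * convPost (coaction (toGroup b)) w' = 1 := by
    rw [← map_mul, hw, map_one]
  have h2 : convPost L w * convPost L w' = 1 := by
    rw [← map_mul, hw, map_one]
  have h3 : convPost (coaction (toGroup b)) w = convPost L w * y := by
    have := congr(convPre π $(coaction_univ b))
    rw [map_mul] at this
    exact this
  have h4 : convPost (coaction (toGroup b)) (toConv LinearMap.id) =
      convPost L (toConv LinearMap.id) * y := coaction_eq (toGroup b)
  have h5 : convPost (coaction (toGroup b)) (proj b) = convPost L (proj b) := by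
    change convPost _ (toConv LinearMap.id * w') = convPost _ (toConv LinearMap.id * w')
    rw [map_mul, map_mul, h4]
    rw [h3] at h1
    have h6 : y * convPost (coaction (toGroup b)) w' = convPost L w' := by
      linear_combination convPost L w' * h1 - y * convPost (coaction (toGroup b)) w' * h2
    rw [mul_assoc, h6]
  exact congr(($h5).ofConv a)

theorem proj_coinvariant {c : UAlg b} (hc : c ∈ coinvariants (toGroup b)) :
    (proj b).ofConv c = c * (univInv b).ofConv 1 :=
  conv_apply_coinvariant (toGroup b) LinearMap.id (univInv b) hc

theorem univ_one_mem : univ b 1 ∈ coinvariants (toGroup b) := by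
  rw [mem_coinvariants]
  simp [coaction, comul_univ, Algebra.TensorProduct.one_def]

/-- A linear retraction of `U(Γ)`-functions onto the coinvariants. -/
def retract : UAlg b →ₗ[R] coinvariants (toGroup b) :=
  LinearMap.codRestrict (coinvariants (toGroup b)).toSubmodule
    (LinearMap.mulLeft R (univ b 1) ∘ₗ (proj b).ofConv)
    fun a => (coinvariants (toGroup b)).mul_mem (univ_one_mem b) (proj_mem b a)

theorem coe_retract (a : UAlg b) : (retract b a : UAlg b) = univ b 1 * (proj b).ofConv a := rfl

theorem retract_coe (c : coinvariants (toGroup b)) : retract b c = c := by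
  apply Subtype.val_injective
  rw [coe_retract, proj_coinvariant b c.2]
  linear_combination (c : UAlg b) * univ_one_mul b

theorem retract_comp_val :
    retract b ∘ₗ (coinvariants (toGroup b)).val.toLinearMap = LinearMap.id :=
  LinearMap.ext fun c => retract_coe b c

theorem coinv_inj₂ : Function.Injective (Algebra.TensorProduct.map
    (coinvariants (toGroup b)).val (coinvariants (toGroup b)).val) := by
  refine Function.LeftInverse.injective
    (g := TensorProduct.map (retract b) (retract b)) fun x => ?_
  have : TensorProduct.map (retract b) (retract b) ∘ₗ TensorProduct.map
      (coinvariants (toGroup b)).val.toLinearMap (coinvariants (toGroup b)).val.toLinearMap =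
      LinearMap.id := by
    rw [← TensorProduct.map_comp, retract_comp_val, TensorProduct.map_id]
  exact congr($this x)

theorem coinv_inj₃ : Function.Injective (Algebra.TensorProduct.map (coinvariants (toGroup b)).val
    (Algebra.TensorProduct.map (coinvariants (toGroup b)).val (coinvariants (toGroup b)).val)) := by
  refine Function.LeftInverse.injective
    (g := TensorProduct.map (retract b) (TensorProduct.map (retract b) (retract b))) fun x => ?_
  have : TensorProduct.map (retract b) (TensorProduct.map (retract b) (retract b)) ∘ₗ
      TensorProduct.map (coinvariants (toGroup b)).val.toLinearMap
      (TensorProduct.map (coinvariants (toGroup b)).val.toLinearMap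
        (coinvariants (toGroup b)).val.toLinearMap) = LinearMap.id := by
    rw [← TensorProduct.map_comp, ← TensorProduct.map_comp, retract_comp_val,
      TensorProduct.map_id, TensorProduct.map_id]
  exact congr($this x)

theorem comul_left (c : coinvariants (toGroup b)) :
    TensorProduct.map ((coinvariants (toGroup b)).val.toLinearMap ∘ₗ retract b) LinearMap.id
      (comul (R := R) (c : UAlg b)) = comul (R := R) (c : UAlg b) := by
  let L := Algebra.TensorProduct.includeLeft (R := R) (S := R) (A := UAlg b) (B := UAlg b)
  have h : (toConv (comul (R := R) (A := UAlg b)) *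
      convPre (toGroup b : UAlg b →ₗc[R] H) (convPost L (univInv b))).ofConv c =
      comul (R := R) (c : UAlg b) * ((univInv b).ofConv 1 ⊗ₜ 1) :=
    conv_apply_coinvariant (toGroup b) _ _ c.2
  have h2 : toConv (comul (R := R) (A := UAlg b)) *
      convPre (toGroup b : UAlg b →ₗc[R] H) (convPost L (univInv b)) =
      convPost L (proj b) *
        convPost (Algebra.TensorProduct.includeRight (R := R)) (toConv LinearMap.id) := by
    rw [comul_eq, mul_right_comm]
    congr 1
    rw [proj, map_mul]
    rfl
  rw [h2] at h
  have h3 : TensorProduct.map ((coinvariants (toGroup b)).val.toLinearMap ∘ₗ retract b)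
      LinearMap.id (comul (R := R) (c : UAlg b)) = (univ b 1 ⊗ₜ 1) * (convPost L (proj b) *
        convPost (Algebra.TensorProduct.includeRight (R := R)) (toConv LinearMap.id)).ofConv c := by
    simp only [LinearMap.convMul_def, LinearMap.comp_apply]
    generalize comul (R := R) (c : UAlg b) = y
    induction y with
    | zero => simp
    | add y z hy hz => simp only [map_add, hy, hz, mul_add]
    | tmul y z => simp [convPost, coe_retract, L]
  rw [h3, h]
  have h4 : (univ b 1 ⊗ₜ[R] (1 : UAlg b)) * ((univInv b).ofConv 1 ⊗ₜ[R] (1 : UAlg b)) = 1 := by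
    rw [Algebra.TensorProduct.tmul_mul_tmul, univ_one_mul, one_mul, Algebra.TensorProduct.one_def]
  linear_combination comul (R := R) (c : UAlg b) * h4

theorem comul_right (c : coinvariants (toGroup b)) :
    TensorProduct.map LinearMap.id ((coinvariants (toGroup b)).val.toLinearMap ∘ₗ retract b)
      (comul (R := R) (c : UAlg b)) = comul (R := R) (c : UAlg b) := by
  have h := congr(TensorProduct.comm R _ _ $(comul_left b c))
  rwa [← TensorProduct.map_comm, Coalgebra.comm_comul] at h

theorem coinv_comul (c : coinvariants (toGroup b)) :
    comul (R := R) (c : UAlg b) ∈ (Algebra.TensorProduct.map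
      (coinvariants (toGroup b)).val (coinvariants (toGroup b)).val).range := by
  refine ⟨TensorProduct.map (retract b) (retract b) (comul (R := R) (c : UAlg b)), ?_⟩
  have h : TensorProduct.map LinearMap.id ((coinvariants (toGroup b)).val.toLinearMap ∘ₗ retract b)
      (TensorProduct.map ((coinvariants (toGroup b)).val.toLinearMap ∘ₗ retract b) LinearMap.id
      (comul (R := R) (c : UAlg b))) = comul (R := R) (c : UAlg b) := by
    rw [comul_left, comul_right]
  rw [← LinearMap.comp_apply, ← TensorProduct.map_comp, LinearMap.id_comp, LinearMap.comp_id,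
    TensorProduct.map_comp] at h
  exact h

theorem coinv_antipode (c : coinvariants (toGroup b)) :
    HopfAlgebra.antipode R (c : UAlg b) ∈ coinvariants (toGroup b) := by
  rw [mem_coinvariants]
  let π : UAlg b →ₗc[R] H := (toGroup b : UAlg b →ₗc[R] H)
  let L := Algebra.TensorProduct.includeLeft (R := R) (S := R) (A := UAlg b) (B := H)
  let Rr := Algebra.TensorProduct.includeRight (R := R) (A := UAlg b) (B := H)
  let x := convPost L (toConv (LinearMap.id (R := R) (M := UAlg b)))
  let x' := convPost L (toConv (HopfAlgebra.antipode R (A := UAlg b)))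
  let y := convPre π (convPost Rr (toConv (LinearMap.id (R := R) (M := H))))
  let y' := convPre π (convPost Rr (toConv (HopfAlgebra.antipode R (A := H))))
  let z := convPost (coaction (toGroup b)) (toConv (LinearMap.id (R := R) (M := UAlg b)))
  let z' := convPost (coaction (toGroup b)) (toConv (HopfAlgebra.antipode R (A := UAlg b)))
  have hx : x * x' = 1 := by
    simp only [x, x', ← map_mul, LinearMap.id_mul_antipode, map_one]
  have hy : y * y' = 1 := by
    simp only [y, y', ← map_mul, LinearMap.id_mul_antipode, map_one]
  have hz : z * z' = 1 := by
    simp only [z, z', ← map_mul, LinearMap.id_mul_antipode, map_one]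
  have hxy : z = x * y := coaction_eq (toGroup b)
  have h : z' = x' * y' := by
    rw [hxy] at hz
    linear_combination x' * y' * hz - z' * x * x' * hy - z' * hx
  have h2 := conv_apply_coinvariant (toGroup b) x'.ofConv
    (convPost Rr (toConv (HopfAlgebra.antipode R (A := H)))) c.2
  have h3 : z'.ofConv (c : UAlg b) = x'.ofConv c * (convPost Rr (toConv
    (HopfAlgebra.antipode R (A := H)))).ofConv 1 := by rw [h]; exact h2
  refine h3.trans ?_
  simp [x', convPost, L, Rr]

end UAlg

/-- The coordinate ring of `U(Γ)/Γ`: the coinvariants of the coordinate ring of `U(Γ)` under the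
coaction defined by the embedding `Γ → U(Γ)`. Its Hopf algebra structure is the restricted one. -/
abbrev QAlg : Type _ := coinvariants (UAlg.toGroup b)

namespace QAlg

instance : HopfAlgebra R (QAlg b) :=
  subHopf (coinvariants (UAlg.toGroup b)) (UAlg.coinv_inj₂ b) (UAlg.coinv_comul b)
    (UAlg.coinv_antipode b) (UAlg.coinv_inj₃ b)

/-- The inclusion of the coinvariants, i.e. the quotient map `U(Γ) → U(Γ)/Γ`. -/
def incl : QAlg b →ₐc[R] UAlg b :=
  .ofAlgHom (coinvariants (UAlg.toGroup b)).val rfl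
    (AlgHom.ext fun c => map_subComul _ (UAlg.coinv_inj₂ b) (UAlg.coinv_comul b) c)

end QAlg
end Quotient

section GammaSpecific
variable {R : Type u} [CommRing R] (p n : ℕ) [Fact p.Prime] [Algebra (ZMod p) R] (lam : R)

/-- The Hopf algebra map `T ↦ T` of the embedding `Γ^(λ) → 𝒢^(λ)`. -/
def GAlg.toGamma : GAlg lam →ₐc[R] GammaAlg p n lam :=
  .ofAlgHom (GAlg.lift (GammaAlg.T p n lam) GammaAlg.isUnit_one_add)
    (GAlg.algHom_ext (by simp))
    (GAlg.algHom_ext (by simp))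

/-- The Hopf algebra map `T ↦ T ^ (p ^ n)` of `F^n : 𝒢^(λ) → 𝒢^(λ ^ (p ^ n))`. -/
def GAlg.frob : GAlg (lam ^ p ^ n) →ₐc[R] GAlg lam :=
  .ofAlgHom
    (GAlg.lift (GAlg.T lam ^ p ^ n) (by
      have h := (GAlg.isUnit_one_add (lam := lam)).pow (p ^ n)
      rwa [add_pow_prime_pow_of_algebra (R := R), one_pow, mul_pow, ← map_pow] at h))
    (GAlg.algHom_ext (by simp [(Fact.out : p.Prime).ne_zero]))
    (GAlg.algHom_ext (by
      simp [add_pow_prime_pow_of_algebra (R := R), smul_pow]))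

/-- The coordinate ring of `U(Γ^(λ))`, formed with the basis `1, T, …, T ^ (p ^ n - 1)`. -/
abbrev UGammaAlg : Type u := UAlg (GammaAlg.basis p n lam)

/-- The coordinate `X_{T ^ s}` of `U(Γ^(λ))`. -/
abbrev UGammaAlg.X (s : Fin (p ^ n)) : UGammaAlg p n lam := UAlg.X (GammaAlg.basis p n lam) s

/-- The coordinate ring of `U(Γ^(λ))/Γ^(λ)`. -/
abbrev UModGammaAlg : Type u := QAlg (GammaAlg.basis p n lam)

end GammaSpecific

section GroupSchemes
open CategoryTheory AlgebraicGeometry MonoidalCategory CartesianMonoidalCategory MonObj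

/-- Exactness (for the fppf topology) of a sequence `0 → G₁ → G₂ → G₃ → 0` of group schemes:
the first map is the kernel of the second one, and the second one is faithfully flat and locally
of finite presentation. -/
structure ShortExact {S : Scheme.{u}} {G₁ G₂ G₃ : Grp (Over S)} (f : G₁ ⟶ G₂) (g : G₂ ⟶ G₃) :
    Prop where
  isKernel : IsPullback f.hom.hom (toUnit G₁.X) g.hom.hom η[G₃.X]
  flat : Flat g.hom.hom.left
  surjective : Surjective g.hom.hom.left
  locallyOfFinitePresentation : LocallyOfFinitePresentation g.hom.hom.left

variable (R : Type u) [CommRing R]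

/-- Group schemes over `R`. -/
abbrev GroupScheme := Grp (Over (Spec (CommRingCat.of R)))

/-- The affine group scheme of a commutative Hopf algebra. -/
abbrev specGrp (A : Type u) [CommRing A] [HopfAlgebra R A] : GroupScheme R :=
  (hopfSpec (CommRingCat.of R)).obj (.op (CommHopfAlgCat.of R A))

variable {R}

/-- The homomorphism of group schemes defined by a homomorphism of Hopf algebras. -/
abbrev specGrpMap {A B : Type u} [CommRing A] [HopfAlgebra R A] [CommRing B] [HopfAlgebra R B]
    (f : A →ₐc[R] B) : specGrp R B ⟶ specGrp R A :=
  (hopfSpec (CommRingCat.of R)).map (CommHopfAlgCat.ofHom f).op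

/-- The group scheme `𝒢^(λ)`. -/
abbrev scriptG (lam : R) : GroupScheme R := specGrp R (GAlg lam)

variable (p n : ℕ) [Fact p.Prime] [Algebra (ZMod p) R] (lam : R)

/-- The group scheme `Γ^(λ)`. -/
abbrev Gam : GroupScheme R := specGrp R (GammaAlg p n lam)

/-- The unit group scheme `U(Γ^(λ))`. -/
abbrev UGam : GroupScheme R := specGrp R (UGammaAlg p n lam)

/-- The quotient group scheme `U(Γ^(λ))/Γ^(λ)`. -/
abbrev UModGam : GroupScheme R := specGrp R (UModGammaAlg p n lam)

/-- `e : Γ^(λ) → 𝒢^(λ)`. -/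
abbrev eMap : Gam p n lam ⟶ scriptG lam := specGrpMap (GAlg.toGamma p n lam)

/-- `F^n : 𝒢^(λ) → 𝒢^(λ ^ (p ^ n))`. -/
abbrev frobMap : scriptG lam ⟶ scriptG (lam ^ p ^ n) := specGrpMap (GAlg.frob p n lam)

/-- `i : Γ^(λ) → U(Γ^(λ))`. -/
abbrev iMap : Gam p n lam ⟶ UGam p n lam := specGrpMap (UAlg.toGroup (GammaAlg.basis p n lam))

/-- `q : U(Γ^(λ)) → U(Γ^(λ))/Γ^(λ)`. -/
abbrev qMap : UGam p n lam ⟶ UModGam p n lam := specGrpMap (QAlg.incl (GammaAlg.basis p n lam))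

end GroupSchemes

end GrothendieckResolution
end

open CategoryTheory GrothendieckResolution

open scoped TensorProduct Polynomial
open Coalgebra WithConv
noncomputable section
namespace GrothendieckResolution
set_option linter.unusedSectionVars false

/-! ### Exactness of Spec sequences of Hopf algebras. -/

section Schemes
open CategoryTheory AlgebraicGeometry MonoidalCategory CartesianMonoidalCategory MonObj Opposite
variable {R : Type u} [CommRing R]

/-! Let `H` be the function algebra of Γ. In both rows the surjection π onto `H` is cleft: it has a
section ψ that is a coalgebra map and is invertible for convolution. For `U(Γ)` this is the
universal map `univ`. For 𝒢 it is `gammaSection`, given by T^s ↦ T^s for s < p^n. It respects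
comultiplication because Δ(T^s) only involves T^i ⊗ T^j with i, j ≤ s, so the relation T^(p^n) = 0
never intervenes. Its convolution inverse is the antipode composed with it.

A cleft section gives the map P : a ↦ ∑ a₀ ψ⁻¹(π a₁). On `U(Γ)` it takes coinvariant values, and id
= P * (ψ ∘ π). Expanding π a₁ in the basis of `H` shows that the X_{e_i} form a basis of O(U(Γ))
over the coinvariants (`coinvBasis`), so q is faithfully flat and finitely presented. The same
identity shows that an algebra map trivial on the coinvariants factors through π
(`apply_univ_toGroup`), so Γ is the kernel of q. For 𝒢, the Frobenius adjoins a root of the monic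
polynomial X^(p^n) - T, which gives the first row, and P identifies the coinvariants with the image
of the Frobenius (`exists_frob_of_mem_coinvariants`).

The map σ₁ is the point of `U(Γ)` given by `gammaSection`. The map σ₂ exists because 1 + λT is
group-like, which makes X_1 + λX_T a unit. Both are compatible with the embeddings of Γ, hence carry
coinvariants to coinvariants (`map_mem_coinvariants`), and this yields τ₁ and τ₂. They are unique
because q and F^n are injective on functions. -/

theorem isPushout_commAlgCat {C A H : Type u} [CommRing C] [CommRing A] [CommRing H]
    [Algebra R C] [Algebra R A] [Algebra R H] (j : C →ₐ[R] A) (π : A →ₐ[R] H) (ε : C →ₐ[R] R)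
    (hπ : Function.Surjective π) (hcomm : π.comp j = (Algebra.ofId R H).comp ε)
    (hlift : ∀ (D : Type u) [CommRing D] [Algebra R D] (f : A →ₐ[R] D),
      f.comp j = (Algebra.ofId R D).comp ε → ∃ h : H →ₐ[R] D, h.comp π = f) :
    IsPushout (CommAlgCat.ofHom j) (CommAlgCat.ofHom ε) (CommAlgCat.ofHom π)
      (CommAlgCat.ofHom (Algebra.ofId R H)) := by
  refine ⟨⟨by rw [← CommAlgCat.ofHom_comp, ← CommAlgCat.ofHom_comp, hcomm]⟩,
    ⟨Limits.PushoutCocone.isColimitAux' _ fun s => ?_⟩⟩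
  have hs : s.inl.hom.comp j = (Algebra.ofId R s.pt).comp ε := by
    have h1 := congr(($(s.condition)).hom)
    refine h1.trans ?_
    refine AlgHom.ext fun c => ?_
    exact s.inr.hom.commutes (ε c)
  have h := hlift s.pt s.inl.hom hs
  refine ⟨CommAlgCat.ofHom h.choose, ?_, ?_, ?_⟩
  · exact CommAlgCat.hom_ext h.choose_spec
  · exact CommAlgCat.hom_ext (Subsingleton.elim _ _)
  · intro m hm _
    apply CommAlgCat.hom_ext
    refine AlgHom.ext fun x => ?_
    obtain ⟨a, rfl⟩ := hπ x
    have h1 := congr(($hm).hom a)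
    have h2 := congr($h.choose_spec a)
    exact h1.trans h2.symm

theorem isPullback_hopfSpec {R : CommRingCat.{u}} {C A H : CommHopfAlgCat.{u} R} (j : C ⟶ A)
    (π : A ⟶ H)
    (hp : IsPushout (CommAlgCat.ofHom (j.hom : C →ₐ[R] A))
      (CommAlgCat.ofHom (Bialgebra.counitAlgHom R C))
      (CommAlgCat.ofHom (π.hom : A →ₐ[R] H)) (CommAlgCat.ofHom (Algebra.ofId R H))) :
    IsPullback ((hopfSpec R).map π.op).hom.hom (toUnit ((hopfSpec R).obj (.op H)).X)
      ((hopfSpec R).map j.op).hom.hom η[((hopfSpec R).obj (.op C)).X] := by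
  have hb := hp.op.map (algSpec R)
  -- The unit section η is Spec of the counit preceded by the comparison of the monoidal unit with
  -- Spec R, so one corner of the square is moved along `εIso`.
  refine hb.flip.of_iso (Iso.refl _) (Iso.refl _)
    (Functor.Monoidal.εIso (algSpec R)).symm (Iso.refl _) ?_ ?_ ?_ ?_
  · exact (Category.id_comp _).trans (Category.comp_id _).symm |>.symm
  · exact toUnit_unique _ _
  · exact (Category.id_comp _).trans (Category.comp_id _).symm |>.symm
  · rfl

/-- The kernel is represented by A ⊗_C R, with C acting on R by the counit. The last three
hypotheses say that H has the universal property of this pushout, so no kernel ideal has to be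
computed. -/
theorem shortExact_specGrpMap {C A H : Type u} [CommRing C] [CommRing A] [CommRing H]
    [HopfAlgebra R C] [HopfAlgebra R A] [HopfAlgebra R H] (j : C →ₐc[R] A) (π : A →ₐc[R] H)
    (hff : (j : C →+* A).FaithfullyFlat) (hfp : (j : C →+* A).FinitePresentation)
    (hπ : Function.Surjective π) (hcomm : ∀ c, π (j c) = algebraMap R H (counit c))
    (hlift : ∀ (D : Type u) [CommRing D] [Algebra R D] (f : A →ₐ[R] D),
      (∀ c, f (j c) = algebraMap R D (counit c)) → ∃ h : H →ₐ[R] D, ∀ a, h (π a) = f a) :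
    ShortExact (specGrpMap π) (specGrpMap j) := by
  have hl : (specGrpMap j).hom.hom.left = Spec.map (CommRingCat.ofHom (j : C →+* A)) := rfl
  have hfs := (flat_and_surjective_SpecMap_iff (CommRingCat.ofHom (j : C →+* A))).2 hff
  refine ⟨?_, hl ▸ hfs.1, hl ▸ hfs.2, hl ▸ (LocallyOfFinitePresentation.SpecMap_iff _).2 hfp⟩
  have hp := isPushout_commAlgCat (j : C →ₐ[R] A) (π : A →ₐ[R] H) (Bialgebra.counitAlgHom R C) hπ
    (AlgHom.ext hcomm) (fun D _ _ f hf => by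
      obtain ⟨h, hh⟩ := hlift D f fun c => congr($hf c)
      exact ⟨h, AlgHom.ext hh⟩)
  exact isPullback_hopfSpec (R := CommRingCat.of R) _ _ hp

end Schemes

/-! ### Convolution calculus for a Hopf algebra surjection with a section. -/

section Cleft
variable {R : Type*} [CommRing R] {A : Type*} [CommRing A] [HopfAlgebra R A]
  {H : Type*} [CommRing H] [HopfAlgebra R H] (π : A →ₐc[R] H)

/-- Rewriting the convolution through the coaction makes the multiplicativity of the coaction
available. -/
theorem conv_convPre_apply {B : Type*} [CommRing B] [Algebra R B] (f : A →ₗ[R] B)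
    (g : WithConv (H →ₗ[R] B)) (a : A) :
    (toConv f * convPre (π : A →ₗc[R] H) g).ofConv a =
      LinearMap.mul' R B (TensorProduct.map f g.ofConv (coaction π a)) := by
  simp only [LinearMap.convMul_def, LinearMap.comp_apply, coaction, AlgHom.comp_apply,
    Bialgebra.comulAlgHom_apply]
  generalize comul (R := R) a = y
  induction y with
  | zero => simp
  | add y z hy hz => simp only [map_add, hy, hz]
  | tmul y z => simp [convPre]

/-- The coaction is multiplicative and sends c to c ⊗ 1, so c comes out of the left tensor factor.
-/
theorem id_conv_convPre_mul (g : WithConv (H →ₗ[R] A)) {c : A} (hc : c ∈ coinvariants π) (a : A) :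
    (toConv LinearMap.id * convPre (π : A →ₗc[R] H) g).ofConv (c * a) =
      c * (toConv LinearMap.id * convPre (π : A →ₗc[R] H) g).ofConv a := by
  rw [conv_convPre_apply, conv_convPre_apply, map_mul, (mem_coinvariants π).1 hc]
  generalize coaction π a = y
  induction y with
  | zero => simp
  | add y z hy hz => simp only [map_add, mul_add, hy, hz]
  | tmul y z => simp [mul_assoc]

/-- Pulling back along a coalgebra map respects convolution, and π ∘ ψ = id removes π. With g
beginning with ψ⁻¹ the product collapses, which evaluates the projection and the coordinate
functionals on the image of ψ. -/
theorem convPre_section_id_conv (ψ : H →ₗc[R] A) (hψ : ∀ h, π (ψ h) = h)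
    (g : WithConv (H →ₗ[R] A)) :
    convPre ψ (toConv LinearMap.id * convPre (π : A →ₗc[R] H) g) = toConv ψ.toLinearMap * g := by
  rw [map_mul]
  congr 1
  apply WithConv.ext
  ext h
  exact congrArg g.ofConv (hψ h)

end Cleft

/-! ### O(U(Γ)) is finite free over the coinvariants. -/

section Freeness
variable {R : Type u} [CommRing R] {H : Type*} [CommRing H] [HopfAlgebra R H] [IsCocomm R H]
  {ι : Type*} [Fintype ι] [DecidableEq ι] (b : Module.Basis ι R H)

namespace UAlg

/-- The universal linear map as a coalgebra homomorphism. -/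
def univCoalgHom : H →ₗc[R] UAlg b where
  __ := univ b
  counit_comp := LinearMap.ext fun h => counit_univ b h
  map_comp_comul := LinearMap.ext fun h => (comul_univ b h).symm

/-- Thus a = ∑ proj(a₀) ψ(π a₁): each function is a combination of values of ψ = `univ` with
coinvariant coefficients. -/
theorem proj_mul_univ :
    proj b * convPre (toGroup b : UAlg b →ₗc[R] H) (toConv (univ b)) = toConv LinearMap.id := by
  rw [proj, mul_assoc, ← map_mul, mul_comm (univInv b), univ_mul_univInv, map_one, mul_one]

/-- The coordinates of `U(Γ)`-functions with respect to the family `X_{e_i}` over the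
coinvariants. -/
def coinvCoord (i : ι) : WithConv (UAlg b →ₗ[R] UAlg b) :=
  toConv LinearMap.id * convPre (toGroup b : UAlg b →ₗc[R] H)
    (univInv b * toConv (Algebra.linearMap R (UAlg b) ∘ₗ b.coord i))

/-- The two forms serve different ends. The defining one, id * (g ∘ π), gives linearity over the
coinvariants and the values on ψ; this one shows that the values are coinvariant. -/
theorem coinvCoord_eq (i : ι) : coinvCoord b i = proj b * convPre (toGroup b : UAlg b →ₗc[R] H)
    (toConv (Algebra.linearMap R (UAlg b) ∘ₗ b.coord i)) := by
  rw [coinvCoord, proj, map_mul, mul_assoc]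

theorem coinvCoord_mem (i : ι) (a : UAlg b) :
    (coinvCoord b i).ofConv a ∈ coinvariants (toGroup b) := by
  rw [coinvCoord_eq, LinearMap.convMul_def]
  simp only [LinearMap.comp_apply]
  generalize comul (R := R) a = y
  induction y with
  | zero => simp
  | add y z hy hz => simpa only [map_add] using add_mem hy hz
  | tmul y z =>
    simp only [TensorProduct.map_tmul, LinearMap.mul'_apply]
    exact mul_mem (proj_mem b y) (Subalgebra.algebraMap_mem _ _)

/-- Expand π a₁ in the basis inside `proj_mul_univ`. -/
theorem sum_coinvCoord_mul (a : UAlg b) :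
    ∑ i, (coinvCoord b i).ofConv a * univ b (b i) = a := by
  have h := congr(($(proj_mul_univ b)).ofConv a)
  refine Eq.trans ?_ h
  simp only [coinvCoord_eq, LinearMap.convMul_def, LinearMap.comp_apply]
  generalize comul (R := R) a = y
  induction y with
  | zero => simp
  | add y z hy hz => simp only [map_add, add_mul, Finset.sum_add_distrib, hy, hz]
  | tmul y z =>
    simp only [TensorProduct.map_tmul, LinearMap.mul'_apply, mul_assoc, ← Finset.mul_sum]
    congr 1
    change ∑ i, algebraMap R (UAlg b) (b.repr (toGroup b z) i) * univ b (b i) =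
      univ b (toGroup b z)
    conv_rhs => rw [← b.sum_repr (toGroup b z)]
    simp_rw [map_sum, map_smul]
    simp only [Algebra.smul_def]

/-- On the image of ψ the factors ψ and ψ⁻¹ cancel, leaving the i-th coordinate form. The
functionals are therefore dual to the X_{e_i}. -/
theorem coinvCoord_univ (i : ι) (h : H) :
    (coinvCoord b i).ofConv (univ b h) = algebraMap R (UAlg b) (b.repr h i) := by
  have h1 := convPre_section_id_conv (toGroup b) (univCoalgHom b) (toGroup_univ b)
    (univInv b * toConv (Algebra.linearMap R (UAlg b) ∘ₗ b.coord i))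
  have h2 : toConv (univCoalgHom b).toLinearMap * (univInv b *
      toConv (Algebra.linearMap R (UAlg b) ∘ₗ b.coord i)) =
      toConv (Algebra.linearMap R (UAlg b) ∘ₗ b.coord i) := by
    rw [← mul_assoc, show toConv (univCoalgHom b).toLinearMap * univInv b = 1 from
      univ_mul_univInv b, one_mul]
  exact congr(($(h1.trans h2)).ofConv h)

/-- The coordinates `X_{e_i}` form a basis of the functions on `U(Γ)` over those on `U(Γ)/Γ`. -/
def coinvBasis : Module.Basis ι (coinvariants (toGroup b)) (UAlg b) :=
  .mk (v := fun i => univ b (b i))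
    (by
      rw [Fintype.linearIndependent_iff]
      intro g hg i
      -- The i-th dual functional is linear over the coinvariants, so applying it to the relation
      -- isolates `g i`.
      have h := congr((coinvCoord b i).ofConv $hg)
      simp only [map_sum, map_zero, Subalgebra.smul_def, smul_eq_mul] at h
      have h2 : ∀ j, (coinvCoord b i).ofConv ((g j : UAlg b) * univ b (b j)) =
          g j * algebraMap R (UAlg b) (b.repr (b j) i) := fun j => by
        rw [← coinvCoord_univ]
        exact id_conv_convPre_mul (toGroup b) _ (g j).2 _
      simp only [h2, Module.Basis.repr_self, Finsupp.single_apply] at h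
      apply Subtype.val_injective
      simpa using h)
    (by
      intro a _
      rw [← sum_coinvCoord_mul b a]
      refine sum_mem fun i _ => ?_
      exact Submodule.smul_mem _ (⟨_, coinvCoord_mem b i a⟩ : coinvariants (toGroup b))
        (Submodule.subset_span ⟨i, rfl⟩))

/-- The composite ε ∘ ψ is the convolution unit, hence so is ε ∘ ψ⁻¹, and `proj` differs from the
identity only by the factor ψ⁻¹ ∘ π. -/
theorem counit_proj (a : UAlg b) : counit (R := R) ((proj b).ofConv a) = counit (R := R) a := by
  have h1 : convPost (Bialgebra.counitAlgHom R (UAlg b)) (toConv (univ b)) = 1 := by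
    apply WithConv.ext
    ext h
    exact counit_univ b h
  have h2 : convPost (Bialgebra.counitAlgHom R (UAlg b)) (univInv b) = 1 := by
    have := congr(convPost (Bialgebra.counitAlgHom R (UAlg b)) $(univ_mul_univInv b))
    rwa [map_mul, h1, one_mul, map_one] at this
  have h3 : convPost (Bialgebra.counitAlgHom R (UAlg b)) (proj b) =
      convPost (Bialgebra.counitAlgHom R (UAlg b)) (toConv LinearMap.id) := by
    rw [proj, map_mul]
    have : convPost (Bialgebra.counitAlgHom R (UAlg b))
        (convPre (toGroup b : UAlg b →ₗc[R] H) (univInv b)) = 1 :=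
      (congr(convPre (toGroup b : UAlg b →ₗc[R] H) $h2)).trans (map_one _)
    rw [this, mul_one]
  exact congr(($h3).ofConv a)

/-- An algebra homomorphism that is trivial on the coinvariants is determined by the image
in the functions on `Γ`. -/
theorem apply_univ_toGroup {D : Type*} [CommRing D] [Algebra R D] (f : UAlg b →ₐ[R] D)
    (hf : ∀ c ∈ coinvariants (toGroup b), f c = algebraMap R D (counit (R := R) c)) (a : UAlg b) :
    f (univ b (toGroup b a)) = f a := by
  -- Since `proj` takes coinvariant values and preserves the counit, f ∘ `proj` is trivial. Applying
  -- f to id = proj * (ψ ∘ π) then leaves f = f ∘ ψ ∘ π.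
  have h1 : convPost f (proj b) = 1 := by
    apply WithConv.ext
    ext a
    refine (hf _ (proj_mem b a)).trans ?_
    rw [counit_proj]
    rfl
  have h2 := congr(convPost f $(proj_mul_univ b))
  rw [map_mul, h1, one_mul] at h2
  exact congr(($h2).ofConv a)

end UAlg

namespace QAlg

/-- The extension is finite free by `coinvBasis`. A nonempty basis gives faithfulness, and a
finitely presented module structure gives a finitely presented algebra. -/
theorem incl_faithfullyFlat_and_finitePresentation [Nonempty ι] :
    (incl b : QAlg b →+* UAlg b).FaithfullyFlat ∧
    (incl b : QAlg b →+* UAlg b).FinitePresentation := by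
  have : Module.Free (QAlg b) (UAlg b) := .of_basis (UAlg.coinvBasis b)
  have : Module.Finite (QAlg b) (UAlg b) := .of_basis (UAlg.coinvBasis b)
  constructor
  · change (algebraMap (QAlg b) (UAlg b)).FaithfullyFlat
    rw [RingHom.faithfullyFlat_algebraMap_iff]
    exact .of_linearEquiv _ _ (UAlg.coinvBasis b).repr
  · change (algebraMap (QAlg b) (UAlg b)).FinitePresentation
    rw [RingHom.finitePresentation_algebraMap]
    have := Module.finitePresentation_of_projective (QAlg b) (UAlg b)
    infer_instance

end QAlg

end Freeness

/-! ### Exactness of the row of `U(Γ)`. -/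

section UnitGroupRow
variable {R H : Type u} [CommRing R] [CommRing H] [HopfAlgebra R H] [IsCocomm R H]
  {ι : Type} [Fintype ι] [DecidableEq ι] [Nonempty ι] (b : Module.Basis ι R H)

theorem shortExact_toGroup_incl :
    ShortExact (specGrpMap (UAlg.toGroup b)) (specGrpMap (QAlg.incl b)) := by
  refine shortExact_specGrpMap (QAlg.incl b) (UAlg.toGroup b)
    (QAlg.incl_faithfullyFlat_and_finitePresentation b).1
    (QAlg.incl_faithfullyFlat_and_finitePresentation b).2
    (fun h => ⟨_, UAlg.toGroup_univ b h⟩) (fun c => ?_)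
    (fun D _ _ f hf => ?_)
  -- Apply ε ⊗ id to (id ⊗ π)(Δ c) = c ⊗ 1: the left side becomes π(c), the right side the scalar
  -- ε(c).
  · have h := congr(TensorProduct.lid R H (TensorProduct.map (counit (R := R)) LinearMap.id
      $((mem_coinvariants (UAlg.toGroup b)).1 c.2)))
    have h2 : TensorProduct.lid R H (TensorProduct.map (counit (R := R)) LinearMap.id
        (coaction (UAlg.toGroup b) (c : UAlg b))) = UAlg.toGroup b (c : UAlg b) := by
      have h3 := congr(UAlg.toGroup b
        (TensorProduct.lid R _ $(Coalgebra.rTensor_counit_comul (R := R) (c : UAlg b))))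
      simp only [TensorProduct.lid_tmul, one_smul] at h3
      rw [← h3]
      simp only [coaction, AlgHom.comp_apply, Bialgebra.comulAlgHom_apply]
      generalize comul (R := R) (c : UAlg b) = y
      induction y with
      | zero => simp
      | add y z hy hz => simp only [map_add, hy, hz]
      | tmul y z => simp
    rw [h2] at h
    refine h.trans ?_
    simp only [TensorProduct.map_tmul, TensorProduct.lid_tmul, LinearMap.id_apply,
      Algebra.smul_def, mul_one]
    rfl
  -- From f = f ∘ ψ ∘ π it follows that f kills the kernel of π, so it descends along the
  -- surjection.
  · have h := UAlg.apply_univ_toGroup b f (fun c hc => hf ⟨c, hc⟩)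
    have hsurj : Function.Surjective (UAlg.toGroup b : UAlg b →ₐ[R] H) :=
      fun h => ⟨_, UAlg.toGroup_univ b h⟩
    refine ⟨AlgHom.liftOfSurjective (UAlg.toGroup b : UAlg b →ₐ[R] H) hsurj f fun a ha => ?_,
      fun a => AlgHom.liftOfSurjective_apply _ hsurj _ _ _⟩
    rw [RingHom.mem_ker] at ha ⊢
    refine (h a).symm.trans ?_
    rw [show UAlg.toGroup b a = 0 from ha, map_zero, map_zero]

end UnitGroupRow

/-! ### Monic extensions. -/

theorem adjoinRoot_of_faithfullyFlat {S : Type*} [CommRing S] {g : S[X]} (hg : g.Monic)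
    (h0 : Nontrivial S → g.natDegree ≠ 0) : (AdjoinRoot.of g).FaithfullyFlat := by
  -- Over the zero ring the degree carries no information, but the map is bijective there.
  rcases subsingleton_or_nontrivial S with hS | hS
  · have : Subsingleton (AdjoinRoot g) := Module.subsingleton S _
    exact .of_bijective ⟨Function.injective_of_subsingleton _, fun x => ⟨0, Subsingleton.elim _ _⟩⟩
  · change (algebraMap S (AdjoinRoot g)).FaithfullyFlat
    rw [RingHom.faithfullyFlat_algebraMap_iff]
    have : Nonempty (Fin g.natDegree) := ⟨⟨0, Nat.pos_of_ne_zero (h0 hS)⟩⟩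
    exact .of_linearEquiv _ _ (AdjoinRoot.powerBasisAux' hg).repr

theorem adjoinRoot_of_finitePresentation {S : Type*} [CommRing S] {g : S[X]} (hg : g.Monic) :
    (AdjoinRoot.of g).FinitePresentation := by
  change (algebraMap S (AdjoinRoot g)).FinitePresentation
  rw [RingHom.finitePresentation_algebraMap]
  have := hg.free_adjoinRoot
  have := hg.finite_adjoinRoot
  have := Module.finitePresentation_of_projective S (AdjoinRoot g)
  infer_instance

/-! ### Exactness of the Frobenius row. -/

section Frobenius
variable {R : Type u} [CommRing R] (p n : ℕ) [Fact p.Prime] [Algebra (ZMod p) R] (lam : R)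

namespace GAlg

@[simp] theorem frob_T : frob p n lam (T (lam ^ p ^ n)) = T lam ^ p ^ n := by
  simp [frob]

@[simp] theorem toGamma_T : toGamma p n lam (T lam) = GammaAlg.T p n lam := by
  exact lift_T _ GammaAlg.isUnit_one_add

/-- The equation `X ^ (p ^ n) = T` of `T` over the image of the Frobenius. -/
abbrev frobPoly : (GAlg (lam ^ p ^ n))[X] := Polynomial.X ^ p ^ n - Polynomial.C (T (lam ^ p ^ n))

theorem frobPoly_monic : (frobPoly p n lam).Monic :=
  Polynomial.monic_X_pow_sub_C _ (pow_ne_zero _ (Fact.out : p.Prime).ne_zero)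

theorem root_frobPoly_pow : AdjoinRoot.root (frobPoly p n lam) ^ p ^ n =
    AdjoinRoot.of (frobPoly p n lam) (T (lam ^ p ^ n)) := by
  have h := AdjoinRoot.eval₂_root (frobPoly p n lam)
  simpa [sub_eq_zero] using h

/-- Invertibility can be tested on the p^n-th power, which is the image of the unit 1 + λ^(p^n) T.
-/
theorem isUnit_one_add_root : IsUnit (1 + algebraMap R (AdjoinRoot (frobPoly p n lam)) lam *
    AdjoinRoot.root (frobPoly p n lam)) := by
  refine (isUnit_pow_iff (n := p ^ n) (pow_ne_zero _ (Fact.out : p.Prime).ne_zero)).1 ?_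
  rw [add_pow_prime_pow_of_algebra (R := R), one_pow, mul_pow, root_frobPoly_pow, ← map_pow]
  have h := (isUnit_one_add (lam := lam ^ p ^ n)).map (AdjoinRoot.of (frobPoly p n lam))
  rwa [map_add, map_one, map_mul] at h

/-- `R[T, 1/(1 + λT)]` is obtained by adjoining a `p ^ n`-th root of `T` along the Frobenius. -/
def adjoinRootEquiv : AdjoinRoot (frobPoly p n lam) ≃ₐ[R] GAlg lam :=
  .ofAlgHom
    (AdjoinRoot.liftAlgHom (frobPoly p n lam) (frob p n lam : GAlg (lam ^ p ^ n) →ₐ[R] GAlg lam)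
      (T lam) (by simp [Polynomial.eval₂_sub]))
    (lift (AdjoinRoot.root (frobPoly p n lam)) (isUnit_one_add_root p n lam))
    (algHom_ext (by simp))
    (AdjoinRoot.algHom_ext' (algHom_ext (by simp [root_frobPoly_pow])) (by simp))

theorem adjoinRootEquiv_of (x : GAlg (lam ^ p ^ n)) :
    adjoinRootEquiv p n lam (AdjoinRoot.of _ x) = frob p n lam x := by
  simp [adjoinRootEquiv]

@[simp] theorem adjoinRootEquiv_root :
    adjoinRootEquiv p n lam (AdjoinRoot.root _) = T lam := by
  simp [adjoinRootEquiv]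

theorem frob_eq_comp : (frob p n lam : GAlg (lam ^ p ^ n) →+* GAlg lam) =
    (adjoinRootEquiv p n lam : AdjoinRoot (frobPoly p n lam) →+* GAlg lam).comp
      (AdjoinRoot.of (frobPoly p n lam)) :=
  RingHom.ext fun x => (adjoinRootEquiv_of p n lam x).symm

theorem frob_faithfullyFlat : (frob p n lam : GAlg (lam ^ p ^ n) →+* GAlg lam).FaithfullyFlat := by
  rw [frob_eq_comp]
  refine RingHom.FaithfullyFlat.stableUnderComposition _ _
    (adjoinRoot_of_faithfullyFlat (frobPoly_monic p n lam) fun _ => ?_)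
    (.of_bijective (adjoinRootEquiv p n lam).bijective)
  rw [Polynomial.natDegree_X_pow_sub_C]
  exact pow_ne_zero _ (Fact.out : p.Prime).ne_zero

theorem frob_finitePresentation :
    (frob p n lam : GAlg (lam ^ p ^ n) →+* GAlg lam).FinitePresentation := by
  rw [frob_eq_comp]
  exact .comp (.of_bijective (adjoinRootEquiv p n lam).bijective)
    (adjoinRoot_of_finitePresentation (frobPoly_monic p n lam))

theorem frob_injective : Function.Injective (frob p n lam) :=
  (frob_faithfullyFlat p n lam).injective

/-- Induction over the powers of `T` with coefficients in the image of the Frobenius. -/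
theorem frob_induction {P : GAlg lam → Prop} (hadd : ∀ x y, P x → P y → P (x + y))
    (hpow : ∀ c k, P (frob p n lam c * T lam ^ k)) (x : GAlg lam) : P x := by
  obtain ⟨y, rfl⟩ := (adjoinRootEquiv p n lam).surjective x
  obtain ⟨f, rfl⟩ := AdjoinRoot.mk_surjective y
  induction f using Polynomial.induction_on' with
  | add f g hf hg => simpa only [map_add] using hadd _ _ hf hg
  | monomial k c =>
    rw [← Polynomial.C_mul_X_pow_eq_monomial, map_mul, map_pow, AdjoinRoot.mk_C, AdjoinRoot.mk_X,
      map_mul, map_pow, adjoinRootEquiv_of, adjoinRootEquiv_root]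
    exact hpow c k

end GAlg

theorem shortExact_toGamma_frob : ShortExact (eMap p n lam) (frobMap p n lam) := by
  refine shortExact_specGrpMap (GAlg.frob p n lam) (GAlg.toGamma p n lam)
    (GAlg.frob_faithfullyFlat p n lam) (GAlg.frob_finitePresentation p n lam) (fun h => ?_)
    (fun c => ?_) (fun D _ _ f hf => ?_)
  -- A class modulo T^(p^n) has a polynomial representative, and that polynomial can be evaluated at
  -- the coordinate of 𝒢.
  · obtain ⟨f, rfl⟩ := AdjoinRoot.mk_surjective h
    refine ⟨Polynomial.aeval (GAlg.T lam) f, ?_⟩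
    have h := Polynomial.aeval_algHom_apply
      (GAlg.toGamma p n lam : GAlg lam →ₐ[R] GammaAlg p n lam) (GAlg.T lam) f
    refine h.symm.trans ?_
    refine Eq.trans ?_ (AdjoinRoot.aeval_eq f)
    exact congr(Polynomial.aeval $(GAlg.toGamma_T p n lam) f)
  · have h : (GAlg.toGamma p n lam : GAlg lam →ₐ[R] GammaAlg p n lam).comp
        (GAlg.frob p n lam : GAlg (lam ^ p ^ n) →ₐ[R] GAlg lam) =
        (Algebra.ofId R (GammaAlg p n lam)).comp (Bialgebra.counitAlgHom R _) :=
      GAlg.algHom_ext (by simp [GammaAlg.T_pow])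
    exact congr($h c)
  -- Triviality on the Frobenius image, tested at T, reads f(T)^(p^n) = 0, which is the defining
  -- relation of Γ.
  · have h := hf (GAlg.T _)
    rw [GAlg.frob_T, map_pow, GAlg.counit_T, map_zero] at h
    refine ⟨GammaAlg.lift (f (GAlg.T lam)) h, fun a => ?_⟩
    have h : (GammaAlg.lift (f (GAlg.T lam)) h).comp
        (GAlg.toGamma p n lam : GAlg lam →ₐ[R] GammaAlg p n lam) = f :=
      GAlg.algHom_ext (by simp)
    exact congr($h a)

end Frobenius

/-! ### The coalgebra section for 𝒢, the map σ₁ and the coinvariants of 𝒢. -/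

section Section
variable {R : Type u} [CommRing R] (p n : ℕ) [Fact p.Prime] [Algebra (ZMod p) R] (lam : R)

/-- The linear map `R[T]/(T ^ (p ^ n)) → R[T, 1/(1 + λT)]` with `T ^ s ↦ T ^ s` for `s < p ^ n`. -/
def gammaSection : GammaAlg p n lam →ₗ[R] GAlg lam :=
  (GammaAlg.basis p n lam).constr R fun s => GAlg.T lam ^ (s : ℕ)

theorem gammaSection_T_pow {k : ℕ} (hk : k < p ^ n) :
    gammaSection p n lam (GammaAlg.T p n lam ^ k) = GAlg.T lam ^ k := by
  rw [← GammaAlg.basis_apply p n lam ⟨k, hk⟩, gammaSection, Module.Basis.constr_basis]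

theorem gammaSection_one : gammaSection p n lam 1 = 1 := by
  simpa using gammaSection_T_pow p n lam (pow_pos (Fact.out : p.Prime).pos n)

/-- The tensors of bidegree at most `(k, k)`. -/
def degLE (k : ℕ) : Submodule R (GammaAlg p n lam ⊗[R] GammaAlg p n lam) :=
  Submodule.span R
    {x | ∃ i j, i ≤ k ∧ j ≤ k ∧ x = (GammaAlg.T p n lam ^ i) ⊗ₜ[R] (GammaAlg.T p n lam ^ j)}

/-- A factor Δ(T) raises each of the two degrees by at most one. While k + 1 < p^n no power is
truncated, so the merely linear section behaves multiplicatively here. -/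
theorem mul_comul_T_of_degLE {k : ℕ} {x : GammaAlg p n lam ⊗[R] GammaAlg p n lam}
    (hx : x ∈ degLE p n lam k) :
    x * comul (GammaAlg.T p n lam) ∈ degLE p n lam (k + 1) ∧
    (k + 1 < p ^ n →
      TensorProduct.map (gammaSection p n lam) (gammaSection p n lam)
        (x * comul (GammaAlg.T p n lam)) =
      TensorProduct.map (gammaSection p n lam) (gammaSection p n lam) x *
        comul (GAlg.T lam)) := by
  induction hx using Submodule.span_induction with
  | zero => simp
  | add x y _ _ hx hy =>
    rw [add_mul]
    refine ⟨add_mem hx.1 hy.1, fun hk => ?_⟩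
    rw [map_add, map_add, hx.2 hk, hy.2 hk, add_mul]
  | smul r x _ hx =>
    rw [smul_mul_assoc]
    refine ⟨Submodule.smul_mem _ _ hx.1, fun hk => ?_⟩
    rw [map_smul, map_smul, hx.2 hk, smul_mul_assoc]
  | mem x hx =>
    obtain ⟨i, j, hi, hj, rfl⟩ := hx
    have h : (GammaAlg.T p n lam ^ i) ⊗ₜ[R] (GammaAlg.T p n lam ^ j) *
        comul (GammaAlg.T p n lam) =
        (GammaAlg.T p n lam ^ (i + 1)) ⊗ₜ[R] (GammaAlg.T p n lam ^ j) +
        (GammaAlg.T p n lam ^ i) ⊗ₜ[R] (GammaAlg.T p n lam ^ (j + 1)) +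
        lam • (GammaAlg.T p n lam ^ (i + 1)) ⊗ₜ[R] (GammaAlg.T p n lam ^ (j + 1)) := by
      simp [mul_add, pow_succ]
    rw [h]
    refine ⟨add_mem (add_mem ?_ ?_) (Submodule.smul_mem _ _ ?_), fun hk => ?_⟩
    · exact Submodule.subset_span ⟨i + 1, j, by lia, by lia, rfl⟩
    · exact Submodule.subset_span ⟨i, j + 1, by lia, by lia, rfl⟩
    · exact Submodule.subset_span ⟨i + 1, j + 1, by lia, by lia, rfl⟩
    · simp only [map_add, map_smul, TensorProduct.map_tmul,
        gammaSection_T_pow p n lam (k := i) (by lia), gammaSection_T_pow p n lam (k := j) (by lia),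
        gammaSection_T_pow p n lam (k := i + 1) (by lia),
        gammaSection_T_pow p n lam (k := j + 1) (by lia)]
      simp [mul_add, pow_succ]

/-- The degree bound is carried along because it is what permits the next multiplication by Δ(T). -/
theorem map_gammaSection_comul_T_pow (k : ℕ) :
    comul (R := R) (GammaAlg.T p n lam) ^ k ∈ degLE p n lam k ∧
    (k < p ^ n → TensorProduct.map (gammaSection p n lam) (gammaSection p n lam)
      (comul (GammaAlg.T p n lam) ^ k) = comul (GAlg.T lam) ^ k) := by
  induction k with
  | zero =>
    refine ⟨Submodule.subset_span ⟨0, 0, le_rfl, le_rfl, by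
      simp [Algebra.TensorProduct.one_def]⟩, fun _ => ?_⟩
    simp [Algebra.TensorProduct.one_def, gammaSection_one]
  | succ k ih =>
    have h := mul_comul_T_of_degLE p n lam ih.1
    rw [← pow_succ] at h
    exact ⟨h.1, fun hk => by rw [h.2 hk, ih.2 (by lia), pow_succ]⟩

/-- `T ^ s ↦ T ^ s` is a homomorphism of coalgebras. -/
def gammaSectionCoalgHom : GammaAlg p n lam →ₗc[R] GAlg lam where
  __ := gammaSection p n lam
  counit_comp := (GammaAlg.basis p n lam).ext fun s => by
    simp [GammaAlg.basis_apply, gammaSection_T_pow p n lam s.2]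
  map_comp_comul := (GammaAlg.basis p n lam).ext fun s => by
    simp only [LinearMap.comp_apply, GammaAlg.basis_apply, gammaSection_T_pow p n lam s.2,
      Bialgebra.comul_pow]
    exact (map_gammaSection_comul_T_pow p n lam s).2 s.2

theorem toGamma_gammaSection (h : GammaAlg p n lam) :
    GAlg.toGamma p n lam (gammaSection p n lam h) = h := by
  have h1 : (GAlg.toGamma p n lam : GAlg lam →ₐ[R] GammaAlg p n lam).toLinearMap ∘ₗ
      gammaSection p n lam = LinearMap.id :=
    (GammaAlg.basis p n lam).ext fun s => by
      simp [GammaAlg.basis_apply, gammaSection_T_pow p n lam s.2]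
  exact congr($h1 h)

/-- The convolution inverse of `T ^ s ↦ T ^ s`. -/
def gammaSectionInv : WithConv (GammaAlg p n lam →ₗ[R] GAlg lam) :=
  convPre (gammaSectionCoalgHom p n lam) (toConv (HopfAlgebra.antipode R))

/-- This is id * S = 1 on 𝒢, pulled back along the coalgebra section. It makes the section a point
of `U(Γ)` with values in O(𝒢), which is σ₁. -/
theorem gammaSection_mul_inv :
    toConv (gammaSection p n lam) * gammaSectionInv p n lam = 1 := by
  have h := congr(convPre (gammaSectionCoalgHom p n lam)
    $(LinearMap.id_mul_antipode (R := R) (C := GAlg lam)))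
  rw [map_mul, map_one] at h
  exact h

theorem isUnit_gammaSection : IsUnit (toConv (gammaSection p n lam)) :=
  .of_mul_eq_one _ (gammaSection_mul_inv p n lam)

/-- The Hopf algebra map `X_{T ^ s} ↦ T ^ s` of `𝒢^(λ) → U(Γ^(λ))`. -/
def UGammaAlg.toGAlg : UGammaAlg p n lam →ₐc[R] GAlg lam :=
  .ofAlgHom (UAlg.lift _ (gammaSection p n lam) (isUnit_gammaSection p n lam))
    (UAlg.algHom_ext (by
      ext x
      simp only [LinearMap.comp_apply, AlgHom.toLinearMap_apply, AlgHom.comp_apply,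
        Bialgebra.counitAlgHom_apply, UAlg.lift_univ, UAlg.counit_univ]
      exact congr($((gammaSectionCoalgHom p n lam).counit_comp) x)))
    (UAlg.algHom_ext (by
      ext x
      simp only [LinearMap.comp_apply, AlgHom.toLinearMap_apply,
        AlgHom.comp_apply, Bialgebra.comulAlgHom_apply, UAlg.comul_univ, UAlg.lift_univ]
      -- On the universal linear map, compatibility with Δ is exactly the coalgebra property of the
      -- section.
      refine Eq.trans ?_ congr($((gammaSectionCoalgHom p n lam).map_comp_comul) x)
      change _ = TensorProduct.map (gammaSection p n lam) (gammaSection p n lam) (comul x)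
      generalize comul (R := R) x = y
      induction y with
      | zero => simp
      | add y z hy hz => simp only [map_add, hy, hz]
      | tmul y z => simp))

theorem UGammaAlg.toGAlg_univ (h : GammaAlg p n lam) :
    toGAlg p n lam (UAlg.univ _ h) = gammaSection p n lam h :=
  UAlg.lift_univ _ _ (isUnit_gammaSection p n lam) h

theorem UGammaAlg.toGAlg_X (s : Fin (p ^ n)) :
    toGAlg p n lam (UGammaAlg.X p n lam s) = GAlg.T lam ^ (s : ℕ) := by
  rw [UGammaAlg.X, ← UAlg.univ_basis, toGAlg_univ, GammaAlg.basis_apply,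
    gammaSection_T_pow p n lam s.2]

theorem UGammaAlg.toGamma_comp_toGAlg : (GAlg.toGamma p n lam).comp (toGAlg p n lam) =
    UAlg.toGroup (GammaAlg.basis p n lam) := by
  have h : ((GAlg.toGamma p n lam : GAlg lam →ₐ[R] GammaAlg p n lam).comp
      (toGAlg p n lam : UGammaAlg p n lam →ₐ[R] GAlg lam)) =
      (UAlg.toGroup (GammaAlg.basis p n lam) : UGammaAlg p n lam →ₐ[R] GammaAlg p n lam) :=
    UAlg.algHom_ext (LinearMap.ext fun x => by
      simp [toGAlg_univ, toGamma_gammaSection])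
  exact BialgHom.ext fun x => congr($h x)

theorem coaction_toGamma_T : coaction (GAlg.toGamma p n lam) (GAlg.T lam) =
    GAlg.T lam ⊗ₜ[R] 1 + 1 ⊗ₜ[R] GammaAlg.T p n lam +
      lam • (GAlg.T lam ⊗ₜ[R] GammaAlg.T p n lam) := by
  simp [coaction]

/-- The p^n-th power is additive, and T^(p^n) vanishes on Γ, so only T^(p^n) ⊗ 1 survives in the
coaction of T^(p^n). -/
theorem frob_mem_coinvariants (c : GAlg (lam ^ p ^ n)) :
    GAlg.frob p n lam c ∈ coinvariants (GAlg.toGamma p n lam) := by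
  have h : (coaction (GAlg.toGamma p n lam)).comp
      (GAlg.frob p n lam : GAlg (lam ^ p ^ n) →ₐ[R] GAlg lam) =
      Algebra.TensorProduct.includeLeft.comp
        (GAlg.frob p n lam : GAlg (lam ^ p ^ n) →ₐ[R] GAlg lam) :=
    GAlg.algHom_ext (by
      simp [coaction_toGamma_T, add_pow_prime_pow_of_algebra (R := R), smul_pow, GammaAlg.T_pow])
  exact congr($h c)

/-- The map P = id * (ψ⁻¹ ∘ π), with ψ = `gammaSection`, fixes coinvariants because ψ⁻¹(1) = 1. It
is linear over the Frobenius image and is the counit on the image of ψ, so all its values lie in the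
Frobenius image. -/
theorem exists_frob_of_mem_coinvariants {a : GAlg lam}
    (ha : a ∈ coinvariants (GAlg.toGamma p n lam)) : ∃ c, GAlg.frob p n lam c = a := by
  let P := toConv LinearMap.id *
    convPre (GAlg.toGamma p n lam : GAlg lam →ₗc[R] GammaAlg p n lam) (gammaSectionInv p n lam)
  have h1 : P.ofConv a = a := by
    refine (conv_apply_coinvariant (GAlg.toGamma p n lam) LinearMap.id
      (gammaSectionInv p n lam) ha).trans ?_
    have : (gammaSectionInv p n lam).ofConv 1 = 1 := by
      change HopfAlgebra.antipode R (gammaSection p n lam 1) = 1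
      simp [gammaSection_one]
    simp [this]
  have h2 : ∀ h, P.ofConv (gammaSection p n lam h) = algebraMap R (GAlg lam) (counit h) := by
    intro h
    have := (convPre_section_id_conv (GAlg.toGamma p n lam) (gammaSectionCoalgHom p n lam)
      (toGamma_gammaSection p n lam) (gammaSectionInv p n lam)).trans (gammaSection_mul_inv p n lam)
    exact congr(($this).ofConv h)
  rw [← h1]
  refine GAlg.frob_induction p n lam (P := fun x => ∃ c, GAlg.frob p n lam c = P.ofConv x)
    (fun x y hx hy => ?_) (fun c k => ?_) a
  · obtain ⟨c, hc⟩ := hx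
    obtain ⟨d, hd⟩ := hy
    exact ⟨c + d, by rw [map_add, map_add, hc, hd]⟩
  · have hk : k % p ^ n < p ^ n := Nat.mod_lt _ (pow_pos (Fact.out : p.Prime).pos n)
    -- Division of k by p^n moves the full p^n-th powers into the Frobenius coefficient and leaves a
    -- power of T in the range of the section.
    have h3 : GAlg.frob p n lam c * GAlg.T lam ^ k =
        GAlg.frob p n lam (c * GAlg.T _ ^ (k / p ^ n)) *
          gammaSection p n lam (GammaAlg.T p n lam ^ (k % p ^ n)) := by
      rw [gammaSection_T_pow p n lam hk, map_mul, map_pow, GAlg.frob_T, ← pow_mul, mul_assoc,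
        ← pow_add, Nat.div_add_mod]
    refine ⟨c * GAlg.T _ ^ (k / p ^ n) *
      algebraMap R _ (counit (GammaAlg.T p n lam ^ (k % p ^ n))), ?_⟩
    rw [h3, id_conv_convPre_mul (GAlg.toGamma p n lam) _ (frob_mem_coinvariants p n lam _)]
    change _ = _ * P.ofConv _
    rw [h2, map_mul]
    congr 1
    exact AlgHomClass.commutes (GAlg.frob p n lam) _

end Section

/-! ### Factoring Hopf algebra maps through an injective one. -/

section Factorization
variable {R : Type*} [CommRing R] {A B C H : Type*} [CommRing A] [CommRing B] [CommRing C]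
  [CommRing H] [HopfAlgebra R A] [HopfAlgebra R B] [HopfAlgebra R C] [HopfAlgebra R H]

/-- Because ρ ∘ f = π, the map f intertwines the two coactions. -/
theorem map_mem_coinvariants (f : A →ₐc[R] B) (π : A →ₐc[R] H) (ρ : B →ₐc[R] H)
    (h : ρ.comp f = π) {a : A} (ha : a ∈ coinvariants π) : f a ∈ coinvariants ρ := by
  rw [mem_coinvariants] at ha ⊢
  have h1 : coaction ρ (f a) = Algebra.TensorProduct.map (f : A →ₐ[R] B) (.id R H)
      (coaction π a) := by
    subst h
    simp only [coaction, AlgHom.comp_apply, Bialgebra.comulAlgHom_apply]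
    rw [← CoalgHomClass.map_comp_comul_apply f a]
    generalize comul (R := R) a = y
    induction y with
    | zero => simp
    | add y z hy hz => simp only [map_add, hy, hz]
    | tmul y z => simp
  rw [h1, ha]
  simp

/-- The comultiplication of the factor is checked after j ⊗ j. Over a general base the injectivity
of j ⊗ j does not follow from that of j, so it is assumed separately. -/
theorem exists_bialgHom_factor (j : C →ₐc[R] A) (hj : Function.Injective j)
    (hjj : Function.Injective (TensorProduct.map (j : C →ₗ[R] A) (j : C →ₗ[R] A)))
    (f : B →ₐc[R] A) (hf : ∀ x, ∃ c, j c = f x) : ∃ t : B →ₐc[R] C, j.comp t = f := by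
  let t : B →ₐ[R] C := (AlgEquiv.ofInjective (j : C →ₐ[R] A) hj).symm.toAlgHom.comp
    ((f : B →ₐ[R] A).codRestrict _ hf)
  have ht : ∀ x, j (t x) = f x := fun x =>
    congr(Subtype.val $((AlgEquiv.ofInjective (j : C →ₐ[R] A) hj).apply_symm_apply
      ((f : B →ₐ[R] A).codRestrict _ hf x)))
  refine ⟨.ofAlgHom t (AlgHom.ext fun x => ?_) (AlgHom.ext fun x => ?_), BialgHom.ext ht⟩
  · have h : counit (R := R) (t x) = counit (R := R) x := by
      rw [← CoalgHomClass.counit_comp_apply j (t x), ht, CoalgHomClass.counit_comp_apply]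
    exact h
  · apply hjj
    have h1 : TensorProduct.map (j : C →ₗ[R] A) (j : C →ₗ[R] A) (comul (R := R) (t x)) =
        comul (R := R) (f x) := by
      rw [← ht]
      exact CoalgHomClass.map_comp_comul_apply j (t x)
    refine Eq.trans ?_ h1.symm
    rw [← CoalgHomClass.map_comp_comul_apply f x]
    simp only [AlgHom.comp_apply, Bialgebra.comulAlgHom_apply]
    generalize comul (R := R) x = y
    induction y with
    | zero => simp
    | add y z hy hz => simp only [map_add, hy, hz]
    | tmul y z => simp [ht]

end Factorization

/-! ### Existence and uniqueness of induced homomorphisms of group schemes. -/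

section SchemeFactorization
open CategoryTheory AlgebraicGeometry
variable {R : Type u} [CommRing R] {A B C : Type u} [CommRing A] [CommRing B] [CommRing C]
  [HopfAlgebra R A] [HopfAlgebra R B] [HopfAlgebra R C]

theorem specGrpMap_comp (f : A →ₐc[R] B) (g : B →ₐc[R] C) :
    specGrpMap g ≫ specGrpMap f = specGrpMap (g.comp f) :=
  ((hopfSpec (CommRingCat.of R)).map_comp _ _).symm

/-- By full faithfulness of `hopfSpec` each candidate τ comes from a Hopf algebra map, so uniqueness
is cancellation of the injective j. -/
theorem existsUnique_specGrpMap_comp (j : C →ₐc[R] A) (hj : Function.Injective j)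
    (hjj : Function.Injective (TensorProduct.map (j : C →ₗ[R] A) (j : C →ₗ[R] A)))
    (f : B →ₐc[R] A) (hf : ∀ x, ∃ c, j c = f x) :
    ∃! τ : specGrp R C ⟶ specGrp R B, specGrpMap j ≫ τ = specGrpMap f := by
  obtain ⟨t, ht⟩ := exists_bialgHom_factor j hj hjj f hf
  refine ⟨specGrpMap t, (specGrpMap_comp t j).trans (by rw [ht]), fun τ hτ => ?_⟩
  obtain ⟨s, rfl⟩ := (hopfSpec.fullyFaithful (R := CommRingCat.of R)).map_surjective τ
  have h1 : specGrpMap (j.comp s.unop.hom) = specGrpMap f := by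
    rw [← specGrpMap_comp]
    exact hτ
  have h2 := congr(($((hopfSpec.fullyFaithful (R := CommRingCat.of R)).map_injective h1)).unop.hom)
  have h3 : s.unop.hom = t := BialgHom.ext fun x => hj (by
    have h4 := congr($(h2.trans ht.symm) x)
    exact h4)
  rw [← h3]
  rfl

end SchemeFactorization

/-! ### Injectivity on tensor squares, and the map σ₂ given by X_T / X_1. -/

section Quotients
variable {R : Type u} [CommRing R]

/-- Flatness makes the tensor square of the Frobenius injective, as needed for τ₁. -/
instance GAlg.flat (lam : R) : Module.Flat R (GAlg lam) :=
  have : Module.Flat R[X] (GAlg lam) := IsLocalization.flat _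
    (Submonoid.powers (1 + Polynomial.C lam * Polynomial.X : R[X]))
  .trans R R[X] (GAlg lam)

section
variable {H : Type*} [CommRing H] [HopfAlgebra R H] [IsCocomm R H]
  {ι : Type*} [Fintype ι] [DecidableEq ι] (b : Module.Basis ι R H)

/-- At a group-like element a convolution product is the product of the values, so ψ takes
group-like elements to units. -/
theorem UAlg.univ_mul_univInv_of_comul {g : H} (hg : comul (R := R) g = g ⊗ₜ g)
    (hg1 : counit (R := R) g = 1) : univ b g * (univInv b).ofConv g = 1 := by
  have h := congr(($(univ_mul_univInv b)).ofConv g)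
  simpa [LinearMap.convMul_def, LinearMap.convOne_def, hg, hg1] using h

theorem UAlg.comul_univ_one : comul (R := R) (univ b 1) = univ b 1 ⊗ₜ univ b 1 := by
  simp [comul_univ, Algebra.TensorProduct.one_def]

theorem QAlg.incl_injective : Function.Injective (incl b) := Subtype.val_injective

theorem QAlg.map_incl_injective : Function.Injective (TensorProduct.map
    (incl b : QAlg b →ₗ[R] UAlg b) (incl b : QAlg b →ₗ[R] UAlg b)) :=
  UAlg.coinv_inj₂ b

end

variable (p n : ℕ) [Fact p.Prime] [Algebra (ZMod p) R] (lam : R)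

namespace UGammaAlg

/-- The function `X_T / X_1` on `U(Γ^(λ))`. -/
def ratio : UGammaAlg p n lam :=
  UAlg.univ (GammaAlg.basis p n lam) (GammaAlg.T p n lam) *
    (UAlg.univInv (GammaAlg.basis p n lam)).ofConv 1

theorem ratio_mul : ratio p n lam * UAlg.univ (GammaAlg.basis p n lam) 1 =
    UAlg.univ (GammaAlg.basis p n lam) (GammaAlg.T p n lam) := by
  rw [ratio]
  linear_combination UAlg.univ (GammaAlg.basis p n lam) (GammaAlg.T p n lam) *
    UAlg.univ_one_mul (GammaAlg.basis p n lam)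

/-- The element 1 + λT of O(Γ) is group-like, so X_1 + λX_T is a unit, and it equals (1 + λ X_T/X_1)
X_1. -/
theorem isUnit_one_add_ratio :
    IsUnit (1 + algebraMap R (UGammaAlg p n lam) lam * ratio p n lam) := by
  let b := GammaAlg.basis p n lam
  let g : GammaAlg p n lam := 1 + lam • GammaAlg.T p n lam
  have h := UAlg.univ_mul_univInv_of_comul b (g := g)
    (by
      simp only [g, map_add, map_smul, GammaAlg.comul_T, Bialgebra.comul_one,
        TensorProduct.add_tmul, TensorProduct.tmul_add, TensorProduct.tmul_smul,
        ← TensorProduct.smul_tmul', smul_add, Algebra.TensorProduct.one_def]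
      abel)
    (by simp [g])
  refine isUnit_of_mul_isUnit_left (y := UAlg.univ b 1)
    (.of_mul_eq_one ((UAlg.univInv b).ofConv g) ?_)
  refine Eq.trans ?_ h
  congr 1
  rw [add_mul, mul_assoc, ratio_mul]
  rw [map_add, map_smul, Algebra.smul_def, one_mul]

/-- After multiplication by the unit Δ(X_1) = X_1 ⊗ X_1 the formula becomes that of Δ(X_T), which is
Δ(T) transported by ψ. -/
theorem comul_ratio : comul (R := R) (ratio p n lam) = ratio p n lam ⊗ₜ[R] 1 +
    1 ⊗ₜ[R] ratio p n lam + lam • (ratio p n lam ⊗ₜ[R] ratio p n lam) := by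
  let b := GammaAlg.basis p n lam
  have hu : IsUnit (comul (R := R) (UAlg.univ b 1)) :=
    (IsUnit.of_mul_eq_one _ (UAlg.univ_one_mul b)).map (Bialgebra.comulAlgHom R (UAlg b))
  refine hu.mul_right_cancel ?_
  rw [← Bialgebra.comul_mul, ratio_mul, UAlg.comul_univ, GammaAlg.comul_T, UAlg.comul_univ_one]
  simp only [add_mul, smul_mul_assoc, Algebra.TensorProduct.tmul_mul_tmul, b, ratio_mul, one_mul,
    map_add, map_smul, TensorProduct.map_tmul]

/-- The Hopf algebra map `T ↦ X_T / X_1` of `U(Γ^(λ)) → 𝒢^(λ)`. -/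
def ofGAlg : GAlg lam →ₐc[R] UGammaAlg p n lam :=
  .ofAlgHom (GAlg.lift (ratio p n lam) (isUnit_one_add_ratio p n lam))
    (GAlg.algHom_ext (by
      simp [ratio, Bialgebra.counit_mul, UAlg.counit_univ]))
    (GAlg.algHom_ext (by
      simp [comul_ratio]))

@[simp] theorem ofGAlg_T : ofGAlg p n lam (GAlg.T lam) = ratio p n lam :=
  GAlg.lift_T _ (isUnit_one_add_ratio p n lam)

/-- This is σ₂ ∘ i = e: on Γ the function X_1 restricts to 1 and X_T to T. -/
theorem toGroup_comp_ofGAlg : (UAlg.toGroup (GammaAlg.basis p n lam)).comp (ofGAlg p n lam) =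
    GAlg.toGamma p n lam := by
  have h : (UAlg.toGroup (GammaAlg.basis p n lam) :
      UGammaAlg p n lam →ₐ[R] GammaAlg p n lam).comp
      (ofGAlg p n lam : GAlg lam →ₐ[R] UGammaAlg p n lam) =
      (GAlg.toGamma p n lam : GAlg lam →ₐ[R] GammaAlg p n lam) :=
    GAlg.algHom_ext (by
      have h := congr(UAlg.toGroup (GammaAlg.basis p n lam) $(ratio_mul p n lam))
      rw [map_mul, UAlg.toGroup_univ, UAlg.toGroup_univ, mul_one] at h
      simpa using h)
  exact BialgHom.ext fun x => congr($h x)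

theorem X_zero (h : 0 < p ^ n) :
    X p n lam ⟨0, h⟩ = UAlg.univ (GammaAlg.basis p n lam) 1 := by
  rw [X, ← UAlg.univ_basis, GammaAlg.basis_apply, pow_zero]

theorem X_one (h : 1 < p ^ n) :
    X p n lam ⟨1, h⟩ = UAlg.univ (GammaAlg.basis p n lam) (GammaAlg.T p n lam) := by
  rw [X, ← UAlg.univ_basis, GammaAlg.basis_apply, pow_one]

end UGammaAlg

end Quotients
end GrothendieckResolution
end

/-! ### The main theorem. -/

open CategoryTheory GrothendieckResolution
theorem theorem3p8 {R : Type*} [CommRing R] (p : ℕ) [Fact p.Prime] [Algebra (ZMod p) R]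
    (n : ℕ) (hn : 0 < n) (lam : R) :
    -- exactness of the two rows
    ShortExact (eMap p n lam) (frobMap p n lam) ∧
    ShortExact (iMap p n lam) (qMap p n lam) ∧
    -- first diagram
    (∃ s₁ : UGammaAlg p n lam →ₐc[R] GAlg lam,
      (∀ s : Fin (p ^ n), s₁ (UGammaAlg.X p n lam s) = GAlg.T lam ^ (s : ℕ)) ∧
      eMap p n lam ≫ specGrpMap s₁ = iMap p n lam ∧
      ∃! τ₁ : scriptG (lam ^ p ^ n) ⟶ UModGam p n lam,
        frobMap p n lam ≫ τ₁ = specGrpMap s₁ ≫ qMap p n lam) ∧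
    -- second diagram
    (IsUnit (UGammaAlg.X p n lam ⟨0, pow_pos (Fact.out : p.Prime).pos n⟩) ∧
    ∃ s₂ : GAlg lam →ₐc[R] UGammaAlg p n lam,
      s₂ (GAlg.T lam) * UGammaAlg.X p n lam ⟨0, pow_pos (Fact.out : p.Prime).pos n⟩ =
        UGammaAlg.X p n lam ⟨1, Nat.one_lt_pow hn.ne' (Fact.out : p.Prime).one_lt⟩ ∧
      iMap p n lam ≫ specGrpMap s₂ = eMap p n lam ∧
      ∃! τ₂ : UModGam p n lam ⟶ scriptG (lam ^ p ^ n),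
        qMap p n lam ≫ τ₂ = specGrpMap s₂ ≫ frobMap p n lam) := by
  have : Nonempty (Fin (p ^ n)) := ⟨⟨0, pow_pos (Fact.out : p.Prime).pos n⟩⟩
  refine ⟨shortExact_toGamma_frob p n lam, shortExact_toGroup_incl (GammaAlg.basis p n lam),
    ⟨UGammaAlg.toGAlg p n lam, UGammaAlg.toGAlg_X p n lam, ?_, ?_⟩, ?_,
    ⟨UGammaAlg.ofGAlg p n lam, ?_, ?_, ?_⟩⟩
  · rw [specGrpMap_comp, UGammaAlg.toGamma_comp_toGAlg]
  · rw [specGrpMap_comp]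
    -- Functions on U(Γ)/Γ pull back along σ₁ to coinvariants on 𝒢, and these are values of the
    -- Frobenius; this produces τ₁.
    refine existsUnique_specGrpMap_comp _ (GAlg.frob_injective p n lam)
      (TensorProduct.map_injective_of_flat_flat _ _
        (GAlg.frob_injective p n lam) (GAlg.frob_injective p n lam)) _ fun c => ?_
    exact exists_frob_of_mem_coinvariants p n lam (map_mem_coinvariants _ _ _
      (UGammaAlg.toGamma_comp_toGAlg p n lam) c.2)
  · rw [UGammaAlg.X_zero]
    exact .of_mul_eq_one _ (UAlg.univ_one_mul _)
  · rw [UGammaAlg.X_zero, UGammaAlg.X_one, UGammaAlg.ofGAlg_T, UGammaAlg.ratio_mul]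
  · rw [specGrpMap_comp, UGammaAlg.toGroup_comp_ofGAlg]
  · rw [specGrpMap_comp]
    -- For τ₂ the easier inclusion suffices: Frobenius values are coinvariant on 𝒢, and σ₂ pulls
    -- them back to coinvariants on `U(Γ)`.
    refine existsUnique_specGrpMap_comp (QAlg.incl (GammaAlg.basis p n lam))
      (QAlg.incl_injective _) (QAlg.map_incl_injective _)
      ((UGammaAlg.ofGAlg p n lam).comp (GAlg.frob p n lam)) fun c => ?_
    exact ⟨⟨_, map_mem_coinvariants _ _ _ (UGammaAlg.toGroup_comp_ofGAlg p n lam)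
      (frob_mem_coinvariants p n lam c)⟩, rfl⟩
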